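/- Let $M$ be a closed, simply connected $4$-manifold (smooth or merely topological) with a finite handle decomposition having exactly one $0$-handle and one $4$-handle, the handles being attached in order of increasing index. That is, $M$ is the union of embedded handles $h(D^k\times D^{4-k})$, $0\le k\le 4$, handles of the same index are disjoint, and each $k$-handle meets the union $X_{k-1}$ of the handles of index $<k$ exactly in its attaching region $h(S^{k-1}\times D^{4-k})\subset\partial X_{k-1}$, where the attaching map is a framed embedding which extends to an embedding of a larger tube with open interior in $\partial X_{k-1}$. Attaching the $k$-handles changes the boundary from $\partial X_{k-1}$ to $$\partial X_k=\Bigl(\partial X_{k-1}\setminus\bigcup h(S^{k-1}\times \operatorname{int}D^{4-k})\Bigr)\cup\bigcup h(D^k\times S^{3-k}).$$ Let $L_1=\partial X_1$ be the boundary of the union of the $0$-handle and the $1$-handles, and let $L_3=\partial X_2$ be the boundary just before the $3$-handles are attached. (In this situation $L_1$ and $L_3$ are connected sums of copies of $S^1\times S^2$; this is recalled for orientation and is not part of the claim.) Let $Q=L_1\cap L_3$, and let $h_\alpha:D^2\times D^2\to M$ be the $2$-handles. Then: 1. $Q=L_1\setminus\bigcup_\alpha h_\alpha(S^1\times\operatorname{int}D^2)$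 and $Q=L_3\setminus\bigcup_\alpha h_\alpha(\operatorname{int}D^2\times S^1)$; that is, $Q$ is $L_1$ minus open tubular neighbourhoods of the attaching circles of the $2$-handles, and also $L_3$ minus open tubular neighbourhoods of their co-circles. 2. For every base point $q\in Q$ the homomorphism $$\pi_1(Q,q)\longrightarrow \pi_1(L_1,q)\times\pi_1(L_3,q)$$ induced by the two inclusions is onto. 3. Equivalently, an arc can be chosen in $Q$ that represents any prescribed pair of elements: if $a,b\in Q$ are joined to $q$ by paths $c_a$ (from $q$ to $a$) and $c_b$ (from $q$ to $b$) in $Q$, then for all $g_1\in\pi_1(L_1,q)$ and $g_3\in\pi_1(L_3,q)$ there is a path $\lambda$ in $Q$ from $a$ to $b$ such that the loop $c_a\,\lambda\,\overline{c_b}$ represents $g_1$ in $\pi_1(L_1,q)$ and $g_3$ in $\pi_1(L_3,q)$. -/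

import Mathlib

open Metric

/-- Euclidean `n`-space; the closed unit ball in it is `D^n`, the unit sphere is `S^(n-1)`
(so `D^0` is a point and `S^(-1)` is empty). -/
abbrev Euc (n : ℕ) : Type := EuclideanSpace ℝ (Fin n)

/-- The 4-dimensional `k`-handle `D^k × D^(4-k)`. -/
def stdHandle (k : ℕ) : Set (Euc k × Euc (4 - k)) :=
  closedBall 0 1 ×ˢ closedBall 0 1

/-- The attaching region `S^(k-1) × D^(4-k)` of the `k`-handle. -/
def attachingRegion (k : ℕ) : Set (Euc k × Euc (4 - k)) :=
  sphere 0 1 ×ˢ closedBall 0 1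

/-- The attaching region without its boundary, `S^(k-1) × int D^(4-k)`:
the open tubular neighbourhood of the attaching sphere `S^(k-1) × 0`. -/
def openAttachingRegion (k : ℕ) : Set (Euc k × Euc (4 - k)) :=
  sphere 0 1 ×ˢ ball 0 1

/-- The belt region `D^k × S^(3-k)` of the `k`-handle. -/
def beltRegion (k : ℕ) : Set (Euc k × Euc (4 - k)) :=
  closedBall 0 1 ×ˢ sphere 0 1

/-- The belt region without its boundary, `int D^k × S^(3-k)`:
the open tubular neighbourhood of the belt sphere (for `k = 2`, the co-circle) `0 × S^(3-k)`. -/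
def openBeltRegion (k : ℕ) : Set (Euc k × Euc (4 - k)) :=
  ball 0 1 ×ˢ sphere 0 1

/-- Finitely many parametrized handles in `M`: there are `num k` handles of index `k`, and the
`i`-th of them is the restriction of `h k i` to `D^k × D^(4-k)` (values elsewhere are ignored). -/
structure HandleSystem (M : Type*) where
  num : ℕ → ℕ
  h : (k : ℕ) → Fin (num k) → Euc k × Euc (4 - k) → M

namespace HandleSystem

variable {M : Type*} (H : HandleSystem M)

/-- The union of all handles of index less than `k`. -/
def sub (k : ℕ) : Set M :=
  ⋃ j, ⋃ (_ : j < k), ⋃ i, H.h j i '' stdHandle j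

/-- The boundary 3-manifold of the handlebody `H.sub k`: attaching the `k`-handles changes the
boundary by deleting the open attaching regions and adding the belt regions. -/
def bd : ℕ → Set M
  | 0 => ∅
  | k + 1 => (bd k \ ⋃ i, H.h k i '' openAttachingRegion k) ∪ ⋃ i, H.h k i '' beltRegion k

/-- `H` is a handle decomposition of the closed 4-manifold `M` with exactly one 0-handle and exactly
one 4-handle, handles being attached in the order of increasing index. -/
structure IsDecomposition [TopologicalSpace M] : Prop where
  num_zero : H.num 0 = 1
  num_four : H.num 4 = 1
  num_large : ∀ k, 4 < k → H.num k = 0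
  continuousOn : ∀ k i, ContinuousOn (H.h k i) (stdHandle k)
  injOn : ∀ k i, Set.InjOn (H.h k i) (stdHandle k)
  /-- handles of the same index are disjoint -/
  disjoint : ∀ k i j, i ≠ j → Disjoint (H.h k i '' stdHandle k) (H.h k j '' stdHandle k)
  /-- a `k`-handle meets the handles of lower index exactly in its attaching region -/
  inter_sub : ∀ k i, H.h k i '' stdHandle k ∩ H.sub k = H.h k i '' attachingRegion k
  /-- the attaching map is a (tame) framed embedding of the attaching sphere in the boundary:
  it extends to an embedding in `H.bd k` of a larger tube, whose interior is open in `H.bd k` -/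
  tube : ∀ k i, ∃ ψ : Euc k × Euc (4 - k) → M,
    ContinuousOn ψ (sphere 0 1 ×ˢ closedBall 0 2) ∧
    Set.InjOn ψ (sphere 0 1 ×ˢ closedBall 0 2) ∧
    Set.EqOn ψ (H.h k i) (attachingRegion k) ∧
    ψ '' (sphere 0 1 ×ˢ closedBall 0 2) ⊆ H.bd k ∧
    ∃ U : Set M, IsOpen U ∧ ψ '' (sphere 0 1 ×ˢ ball 0 2) = U ∩ H.bd k
  /-- the handles fill up `M`, and no boundary is left -/
  sub_five : H.sub 5 = Set.univ
  bd_five : H.bd 5 = ∅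

/-- `L₁`: the boundary (level set) after the 1-handles have been attached to the 0-handle. -/
def L1 : Set M := H.bd 2

/-- `L₃`: the boundary (level set) after the 2-handles, just before the 3-handles are attached. -/
def L3 : Set M := H.bd 3

/-- `Q = L₁ ∩ L₃`. -/
def Q : Set M := H.L1 ∩ H.L3

/-- The inclusion of `Q` in `L₁`. -/
def inclL1 [TopologicalSpace M] : C(H.Q, H.L1) :=
  ⟨Set.inclusion Set.inter_subset_left, continuous_inclusion Set.inter_subset_left⟩

/-- The inclusion of `Q` in `L₃`. -/
def inclL3 [TopologicalSpace M] : C(H.Q, H.L3) :=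
  ⟨Set.inclusion Set.inter_subset_right, continuous_inclusion Set.inter_subset_right⟩

/-- The homomorphism `π₁(Q, q) → π₁(L₁, q) × π₁(L₃, q)` induced by the two inclusions. -/
noncomputable def piOneMap [TopologicalSpace M] (q : H.Q) :
    FundamentalGroup H.Q q →*
      FundamentalGroup H.L1 (H.inclL1 q) × FundamentalGroup H.L3 (H.inclL3 q) :=
  (FundamentalGroup.map H.inclL1 q).prod (FundamentalGroup.map H.inclL3 q)

end HandleSystem

/-! The proof combines a Goursat argument with one half of van Kampen's theorem. `L1` and `L3` arise
from `Q` by gluing in solid tori `D² × S¹`, and paths can be pushed off their core circles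
(`exists_path_homotopic_map`), so `Q` surjects onto each factor. Hence the group `N` of all `g` with
`(g, 1)` in the range is normal in `π₁(L₁)`, and it suffices that `N` is everything. A parallel copy
`S¹ × y`, `‖y‖ = 1`, of an attaching circle lies in `Q` and bounds the disc `D² × y` in `L₃`; joined
to the base point by a path in `Q` it represents an element of `N` (`val_attaching_eq_one`). So
`π₁(L₁) → π₁(L₁)/N` kills the attaching circles, and therefore every loop that contracts in the
union of `L₁` and the 2-handles. Every loop does: `M` arises from this union by adding the 3- and
4-handles, and the 1- and 0-handles upside down. Their cores have dimension at least 3, so simple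
connectivity of `M` descends (`homotopic_L1_union_handles`).

The van Kampen half is `val_eq_of_homotopic_map`, phrased for functors `PathHom` from paths to a
group. Such a functor is extended by a retraction to the complement of the cocores, near which it is
the coboundary of a function. A homotopy then pulls it back to a local cocycle on the plane; a
covering space turns this into a coboundary, and the two sides of the homotopy square get equal
values. -/

section

open Topology unitInterval

/-! ### Path functors and local-to-global principles for paths. -/

/-- A homotopy invariant, multiplicative assignment of elements of a group to paths,
i.e. a functor from the fundamental groupoid to a group. -/
structure PathHom (X : Type*) [TopologicalSpace X] (G : Type*) [Group G] where
  val : ∀ {x y : X}, Path x y → G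
  homotopic : ∀ {x y : X} {p q : Path x y}, p.Homotopic q → val p = val q
  trans : ∀ {x y z : X} (p : Path x y) (q : Path y z), val (p.trans q) = val p * val q

namespace PathHom

variable {X Y G : Type*} [TopologicalSpace X] [TopologicalSpace Y] [Group G]

theorem val_ext (Φ : PathHom X G) {x y x' y' : X} {p : Path x y} {q : Path x' y'}
    (h : ∀ t, p t = q t) : Φ.val p = Φ.val q := by
  have h0 := h 0
  have h1 := h 1
  simp only [Path.source, Path.target] at h0 h1
  subst h0 h1
  congr 1
  ext t
  exact h t

theorem val_refl (Φ : PathHom X G) (x : X) : Φ.val (Path.refl x) = 1 := by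
  have := Φ.trans (Path.refl x) (Path.refl x)
  rw [Path.refl_trans_refl] at this
  simpa using this

theorem val_symm (Φ : PathHom X G) {x y : X} (p : Path x y) : Φ.val p.symm = (Φ.val p)⁻¹ := by
  rw [eq_inv_iff_mul_eq_one, ← Φ.trans,
    Φ.homotopic (q := Path.refl y) ⟨(Path.Homotopy.reflSymmTrans p).symm⟩, Φ.val_refl]

/-- The pullback along a continuous map. -/
def comp (Φ : PathHom Y G) (f : C(X, Y)) : PathHom X G where
  val p := Φ.val (p.map f.continuous)
  homotopic h := Φ.homotopic (h.map f)
  trans p q := by rw [Path.map_trans, Φ.trans]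

theorem val_eq_of_simplyConnected [SimplyConnectedSpace X] (Φ : PathHom X G) {x y x' y' : X}
    (hx : x = x') (hy : y = y') (p : Path x y) (q : Path x' y') : Φ.val p = Φ.val q := by
  subst hx hy
  exact Φ.homotopic (SimplyConnectedSpace.paths_homotopic p q)

/-- The value on the restriction of a curve to the interval from `s` to `t`. -/
def seg (Φ : PathHom X G) (f : C(ℝ, X)) (s t : ℝ) : G :=
  Φ.val ((Path.segment s t).map f.continuous)

/-- Pulled back to the simply connected line, the functor sees only end points, so `r`, `s`, `t` may
come in any order. -/
theorem seg_mul (Φ : PathHom X G) (f : C(ℝ, X)) (r s t : ℝ) :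
    Φ.seg f r s * Φ.seg f s t = Φ.seg f r t := by
  unfold seg
  rw [← Φ.trans, ← Path.map_trans]
  exact (Φ.comp f).val_eq_of_simplyConnected rfl rfl _ _

end PathHom

/-- A property of reals which is preserved along short steps holds everywhere. -/
theorem Real.forall_of_local_step {P : ℝ → Prop} (h0 : P 0)
    (h : ∀ t, ∃ W ∈ 𝓝 t, ∀ r ∈ W, ∀ s ∈ W, P r → P s) (t : ℝ) : P t := by
  have hopen : IsOpen {t | P t} := isOpen_iff_mem_nhds.2 fun t ht => by
    obtain ⟨W, hW, hP⟩ := h t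
    exact Filter.mem_of_superset hW fun s hs => hP t (mem_of_mem_nhds hW) s hs ht
  have hclosed : IsClosed {t | P t} := ⟨isOpen_iff_mem_nhds.2 fun t ht => by
    obtain ⟨W, hW, hP⟩ := h t
    exact Filter.mem_of_superset hW fun s hs hs' => ht (hP s hs t (mem_of_mem_nhds hW) hs')⟩
  have := (isClopen_iff.1 ⟨hclosed, hopen⟩).resolve_left (Set.Nonempty.ne_empty ⟨0, h0⟩)
  exact this.ge (Set.mem_univ t)

/-- A property of paths which is homotopy invariant, closed under concatenation and holds for
small paths holds for all paths. -/
theorem Path.forall_of_local {Y : Type*} [TopologicalSpace Y]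
    (C : ∀ {x y : Y}, Path x y → Prop)
    (hC : ∀ {x y : Y} {p q : Path x y}, p.Homotopic q → C p → C q)
    (htrans : ∀ {x y z : Y} (p : Path x y) (q : Path y z), C p → C q → C (p.trans q))
    (hloc : ∀ y : Y, ∃ W ∈ 𝓝 y, ∀ {x x' : Y} (p : Path x x'), (∀ t, p t ∈ W) → C p)
    {x y : Y} (p : Path x y) : C p := by
  -- For curves on the whole line, subdivision is replaced by the connectedness of `ℝ`.
  have key : ∀ (f : C(ℝ, Y)) (t : ℝ), C ((Path.segment 0 t).map f.continuous) := by
    intro f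
    have hsmall : ∀ t : ℝ, ∃ W ∈ 𝓝 t, ∀ r ∈ W, ∀ s ∈ W,
        C ((Path.segment r s).map f.continuous) := by
      intro t
      obtain ⟨W, hW, hCW⟩ := hloc (f t)
      obtain ⟨ε, hε, hball⟩ := Metric.mem_nhds_iff.1 (f.continuous.continuousAt hW)
      refine ⟨ball t ε, ball_mem_nhds t hε, fun r hr s hs => hCW _ fun u => hball ?_⟩
      apply (convex_ball t ε).segment_subset hr hs
      rw [← Path.range_segment]
      exact ⟨u, rfl⟩
    refine Real.forall_of_local_step ?_ fun t => ?_
    · obtain ⟨W, hW, h⟩ := hsmall 0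
      exact h 0 (mem_of_mem_nhds hW) 0 (mem_of_mem_nhds hW)
    · obtain ⟨W, hW, h⟩ := hsmall t
      refine ⟨W, hW, fun r hr s hs hP => hC ?_ (htrans _ _ hP (h r hr s hs))⟩
      rw [← Path.map_trans]
      exact (SimplyConnectedSpace.paths_homotopic _ _).map f
  have h1 := key p.extend 1
  have : ∀ {x' y' : Y} (hx : x = x') (hy : y = y') (q : Path x' y'), (∀ t, q t = p t) →
      C q → C p := by
    intro x' y' hx hy q hq hCq
    subst hx hy
    convert hCq
    ext t
    exact (hq t).symm
  refine this (by simp) (by simp) _ (fun t => ?_) h1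
  simp [Path.segment, AffineMap.lineMap_apply]

/-! ### Local cocycles on simply connected spaces. -/

/-- On a simply connected space, a function of two variables satisfying the cocycle identity
near the diagonal is a coboundary near the diagonal. -/
theorem exists_coboundary_of_local_cocycle {X G : Type*} [TopologicalSpace X]
    [SimplyConnectedSpace X] [LocallyPathConnectedSpace X] [Group G] (c : X → X → G)
    (hc : ∀ x, ∃ W ∈ 𝓝 x, ∀ a ∈ W, ∀ b ∈ W, ∀ d ∈ W, c a b * c b d = c a d) :
    ∃ g : X → G, ∀ x, ∃ W ∈ 𝓝 x, ∀ a ∈ W, ∀ b ∈ W, c a b = (g a)⁻¹ * g b := by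
  have hc' : ∀ x, ∃ W : Set X, IsOpen W ∧ x ∈ W ∧
      ∀ a ∈ W, ∀ b ∈ W, ∀ d ∈ W, c a b * c b d = c a d := by
    intro x
    obtain ⟨W, hW, h⟩ := hc x
    obtain ⟨W', hsub, ho, hx⟩ := mem_nhds_iff.1 hW
    exact ⟨W', ho, hx, fun a ha b hb d hd => h a (hsub ha) b (hsub hb) d (hsub hd)⟩
  choose W hWo hxW hW using hc'
  let _ : TopologicalSpace G := ⊥
  have _ : DiscreteTopology G := ⟨rfl⟩
  -- Passing from `a` to `b` multiplies both `c i` and `c j` on the right by `c a b`, which cancels: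
  -- the transition functions are constant on overlaps, and the bundle with discrete fibre `G` is a
  -- covering.
  have hconst : ∀ i j, ∀ a ∈ W i ∩ W j, ∀ b ∈ W i ∩ W j,
      (c j a)⁻¹⁻¹ * (c i a)⁻¹ = (c j b)⁻¹⁻¹ * (c i b)⁻¹ := by
    intro i j a ha b hb
    rw [← hW i i (hxW i) a ha.1 b hb.1, ← hW j j (hxW j) a ha.2 b hb.2]
    group
  let Z : FiberBundleCore X X G :=
    { baseSet := W
      isOpen_baseSet := hWo
      indexAt := id
      mem_baseSet_at := hxW
      coordChange := fun i j b v => v * (c i b * (c j b)⁻¹)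
      coordChange_self := by intros; group
      continuousOn_coordChange := by
        rintro i j ⟨a, v⟩ ⟨ha, -⟩
        have : ContinuousWithinAt (fun p : X × G => p.2 * (c i a * (c j a)⁻¹))
            ((W i ∩ W j) ×ˢ Set.univ) (a, v) := by
          apply Continuous.continuousWithinAt
          have : Continuous fun w : G => w * (c i a * (c j a)⁻¹) := continuous_of_discreteTopology
          exact this.comp continuous_snd
        refine this.congr ?_ rfl
        rintro ⟨b, w⟩ ⟨hb, -⟩
        have := hconst j i a ha.symm b hb.symm
        simp only [inv_inv] at this
        simp [this]
      coordChange_comp := by intros; group }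
  have hcov : IsCoveringMap Z.proj :=
    IsFiberBundle.isCoveringMap fun x => ⟨Z.localTriv x, hxW x⟩
  obtain ⟨x₀⟩ : Nonempty X := inferInstance
  -- Simple connectivity gives a global section; its fibre coordinate is the required function `g`.
  obtain ⟨τ, ⟨-, h_lift⟩, -⟩ := hcov.existsUnique_continuousMap_lifts (ContinuousMap.id X) x₀
    (⟨x₀, (1 : G)⟩ : Z.TotalSpace) rfl
  have hproj : ∀ x, (τ x).1 = x := fun x => congr_fun h_lift x
  let g : X → G := fun x => (τ x).2
  refine ⟨g, fun i => ?_⟩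
  have hself : ∀ x, c x x = 1 := fun x => by
    simpa using hW x x (hxW x) x (hxW x) x (hxW x)
  -- In the chart at `i` the section reads `g x * (c i x)⁻¹`. Being continuous with discrete values,
  -- this is constant near `i`, which is the coboundary formula.
  have hcoord : ∀ x, (Z.localTriv i (τ x)).2 = g x * (c i x)⁻¹ := by
    intro x
    change g x * (c (τ x).1 (τ x).1 * (c i (τ x).1)⁻¹) = _
    rw [hself, hproj, one_mul]
  have hcont : ContinuousAt (fun x => (Z.localTriv i (τ x)).2) i := by
    refine continuous_snd.continuousAt.comp
      (ContinuousAt.comp (f := τ) ?_ τ.continuous.continuousAt)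
    refine (Z.localTriv i).continuousOn_toFun.continuousAt ((Z.localTriv i).open_source.mem_nhds ?_)
    change (τ i).1 ∈ W i
    rw [hproj]
    exact hxW i
  have hev : ∀ᶠ x in 𝓝 i, (Z.localTriv i (τ x)).2 = (Z.localTriv i (τ i)).2 := by
    have := hcont.eventually ((isOpen_discrete {(Z.localTriv i (τ i)).2}).mem_nhds rfl)
    filter_upwards [this] with x hx using hx
  refine ⟨_, Filter.inter_mem hev ((hWo i).mem_nhds (hxW i)), ?_⟩
  rintro a ⟨ha, haW⟩ b ⟨hb, hbW⟩
  simp only [Set.mem_ofPred_eq, hcoord] at ha hb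
  rw [← hW i i (hxW i) a haW b hbW] at hb
  have : g b = g a * (c i a)⁻¹ * (c i a * c a b) := by
    rw [ha, ← hb]; group
  rw [this]; group

/-! ### Path functors on an open subset and homotopies in the whole space. -/

theorem Path.trans_mem {Y : Type*} [TopologicalSpace Y] {U : Set Y} {x y z : Y} {p : Path x y}
    {q : Path y z} (hp : ∀ t, p t ∈ U) (hq : ∀ t, q t ∈ U) (t : I) : p.trans q t ∈ U := by
  rw [Path.trans_apply]
  split_ifs
  exacts [hp _, hq _]

/-- Restrict the codomain of a path to a subset containing it. -/
def Path.codRestrict {Y : Type*} [TopologicalSpace Y] {U : Set Y} {x y : Y} (p : Path x y)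
    (h : ∀ t, p t ∈ U) :
    Path (⟨x, by simpa using h 0⟩ : U) (⟨y, by simpa using h 1⟩ : U) where
  toFun t := ⟨p t, h t⟩
  continuous_toFun := by fun_prop
  source' := by simp
  target' := by simp

namespace PathHom

variable {Y G : Type*} [TopologicalSpace Y] [Group G] {U : Set Y}

/-- Paths in the image of a convex set have the same value if they have the same ends. -/
theorem val_eq_of_convex {E : Type*} [AddCommGroup E] [Module ℝ E] [TopologicalSpace E]
    [ContinuousAdd E] [ContinuousSMul ℝ E]
    (Ψ : PathHom U G) (F : C(E, Y)) {B : Set E} (hB : Convex ℝ B)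
    (hBU : ∀ b ∈ B, F b ∈ U) {a b : E} (p q : Path a b) (hp : ∀ t, p t ∈ B) (hq : ∀ t, q t ∈ B) :
    Ψ.val ((p.map F.continuous).codRestrict fun t => hBU _ (hp t)) =
      Ψ.val ((q.map F.continuous).codRestrict fun t => hBU _ (hq t)) := by
  have : ContractibleSpace B := hB.contractibleSpace ⟨a, by simpa using hp 0⟩
  let κ : C(B, U) := ⟨fun b => ⟨F b, hBU _ b.2⟩, by fun_prop⟩
  exact (Ψ.comp κ).homotopic
    (SimplyConnectedSpace.paths_homotopic (p.codRestrict hp) (q.codRestrict hq))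

open Classical in
/-- Let `Ψ` be defined on paths in the open set `U`, and suppose that near every point outside
`U` the functor `Ψ` is the coboundary of a function. Then `Ψ` takes the same values on paths
in `U` which are homotopic in the whole space. -/
theorem val_eq_of_homotopic_map_val (hU : IsOpen U) (Ψ : PathHom U G) (f : Y → G)
    (hf : ∀ y ∉ U, ∃ W ∈ 𝓝 y, ∀ {u u' : U} (p : Path u u'), (∀ t, (p t : Y) ∈ W) →
      Ψ.val p = (f u)⁻¹ * f u')
    {u u' : U} (p q : Path u u')
    (hpq : (p.map continuous_subtype_val).Homotopic (q.map continuous_subtype_val)) :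
    Ψ.val p = Ψ.val q := by
  obtain ⟨H⟩ := hpq
  let pr : ℝ → I := Set.projIcc 0 1 zero_le_one
  let F : C(ℝ × ℝ, Y) := ⟨fun x => H (pr x.1, pr x.2), by
    have : Continuous pr := continuous_projIcc
    fun_prop⟩
  -- `F` is the homotopy, extended to the plane by clamping. Where a segment leaves `U`, the functor
  -- is replaced by the coboundary of `f`; only pairs close to each other matter.
  let c : ℝ × ℝ → ℝ × ℝ → G := fun a b =>
    if h : ∀ t, F (Path.segment a b t) ∈ U then
      Ψ.val (((Path.segment a b).map F.continuous).codRestrict h) else (f (F a))⁻¹ * f (F b)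
  have hseg : ∀ {B : Set (ℝ × ℝ)}, Convex ℝ B → ∀ a ∈ B, ∀ b ∈ B, ∀ t,
      Path.segment a b t ∈ B := by
    intro B hB a ha b hb t
    apply hB.segment_subset ha hb
    rw [← Path.range_segment]
    exact ⟨t, rfl⟩
  have hcU : ∀ {B : Set (ℝ × ℝ)}, Convex ℝ B → ∀ (hBU : ∀ b ∈ B, F b ∈ U), ∀ a b
      (γ : Path a b) (hγ : ∀ t, γ t ∈ B),
      c a b = Ψ.val ((γ.map F.continuous).codRestrict fun t => hBU _ (hγ t)) := by
    intro B hB hBU a b γ hγ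
    have hγ' := hseg hB a (by simpa using hγ 0) b (by simpa using hγ 1)
    have : c a b = _ := dif_pos fun t => hBU _ (hγ' t)
    rw [this]
    exact Ψ.val_eq_of_convex F hB hBU _ _ hγ' hγ
  have hc : ∀ x, ∃ W ∈ 𝓝 x, ∀ a ∈ W, ∀ b ∈ W, ∀ d ∈ W, c a b * c b d = c a d := by
    intro x
    by_cases hx : F x ∈ U
    · obtain ⟨ε, hε, hball⟩ := Metric.mem_nhds_iff.1
        (F.continuous.continuousAt.preimage_mem_nhds (hU.mem_nhds hx))
      have hB := convex_ball x ε
      refine ⟨ball x ε, ball_mem_nhds x hε, fun a ha b hb d hd => ?_⟩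
      have hab := hseg hB a ha b hb
      have hbd := hseg hB b hb d hd
      rw [hcU hB hball a b _ hab, hcU hB hball b d _ hbd,
        hcU hB hball a d ((Path.segment a b).trans (Path.segment b d)) ?_, ← Ψ.trans]
      · refine Ψ.val_ext fun t => Subtype.ext ?_
        simp only [Path.codRestrict, Path.trans_apply, Path.coe_mk_mk, Path.map_coe,
          Function.comp_apply]
        split_ifs <;> rfl
      · exact Path.trans_mem hab hbd
    · obtain ⟨W, hW, hfW⟩ := hf _ hx
      obtain ⟨ε, hε, hball⟩ := Metric.mem_nhds_iff.1
        (F.continuous.continuousAt.preimage_mem_nhds hW)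
      -- Near a point mapped outside `U` both branches of `c` agree, by the hypothesis on `f`.
      have hcf : ∀ a ∈ ball x ε, ∀ b ∈ ball x ε, c a b = (f (F a))⁻¹ * f (F b) := by
        intro a ha b hb
        by_cases h : ∀ t, F (Path.segment a b t) ∈ U
        · have : c a b = _ := dif_pos h
          rw [this]
          exact hfW _ fun t => hball (hseg (convex_ball x ε) a ha b hb t)
        · exact dif_neg h
      refine ⟨ball x ε, ball_mem_nhds x hε, fun a ha b hb d hd => ?_⟩
      rw [hcf a ha b hb, hcf b hb d hd, hcf a ha d hd]
      group
  obtain ⟨g, hg⟩ := exists_coboundary_of_local_cocycle c hc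
  -- Along a curve mapped into `U`, the local values of `c` are those of `Ψ`, and they telescope.
  have key : ∀ (δ : C(ℝ, ℝ × ℝ)) (ζ : C(ℝ, U)), (∀ t, F (δ t) = ζ t) →
      Ψ.seg ζ 0 1 = (g (δ 0))⁻¹ * g (δ 1) := by
    intro δ ζ hδ
    have hloc : ∀ t, ∃ W ∈ 𝓝 t, ∀ r ∈ W, ∀ s ∈ W, Ψ.seg ζ r s = (g (δ r))⁻¹ * g (δ s) := by
      intro t
      obtain ⟨W, hW, hgW⟩ := hg (δ t)
      have hFt : F (δ t) ∈ U := by rw [hδ]; exact (ζ t).2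
      obtain ⟨ε, hε, hball⟩ := Metric.mem_nhds_iff.1
        (Filter.inter_mem hW (F.continuous.continuousAt.preimage_mem_nhds (hU.mem_nhds hFt)))
      obtain ⟨η, hη, hball'⟩ := Metric.mem_nhds_iff.1
        (δ.continuous.continuousAt.preimage_mem_nhds (ball_mem_nhds (δ t) hε))
      refine ⟨ball t η, ball_mem_nhds t hη, fun r hr s hs => ?_⟩
      have hrs : ∀ v, Path.segment r s v ∈ ball t η := by
        intro v
        apply (convex_ball t η).segment_subset hr hs
        rw [← Path.range_segment]
        exact ⟨v, rfl⟩
      rw [← hgW _ (hball (hball' hr)).1 _ (hball (hball' hs)).1,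
        hcU (convex_ball (δ t) ε) (fun b hb => (hball hb).2) _ _
          ((Path.segment r s).map δ.continuous) (fun v => hball' (hrs v))]
      exact Ψ.val_ext fun v => Subtype.ext (hδ _).symm
    refine Real.forall_of_local_step (P := fun t => Ψ.seg ζ 0 t = (g (δ 0))⁻¹ * g (δ t)) ?_
      (fun t => ?_) 1
    · obtain ⟨W, hW, h⟩ := hloc 0
      exact h 0 (mem_of_mem_nhds hW) 0 (mem_of_mem_nhds hW)
    · obtain ⟨W, hW, h⟩ := hloc t
      refine ⟨W, hW, fun r hr s hs hP => ?_⟩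
      rw [← Ψ.seg_mul ζ 0 r s, hP, h r hr s hs]
      group
  have hpr0 : pr 0 = 0 := Set.projIcc_left zero_le_one
  have hpr1 : pr 1 = 1 := Set.projIcc_right zero_le_one
  have hconst : ∀ v : U, Ψ.seg (ContinuousMap.const ℝ v) 0 1 = 1 := fun v => by
    rw [← Ψ.val_refl v]
    exact Ψ.val_ext fun t => rfl
  have hsegI : ∀ {v v' : U} (γ : Path v v'), Ψ.seg γ.extend 0 1 = Ψ.val γ := fun γ => by
    refine Ψ.val_ext fun t => ?_
    simp [Path.segment, AffineMap.lineMap_apply]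
  -- The four sides of the square: `p`, `q` and two constant sides. The constant sides force `g` to
  -- agree at the corners they join.
  have h1 := key ⟨fun t => (0, t), by fun_prop⟩ p.extend fun t => by
    simp [F, Path.extend, pr, Set.IccExtend]
  have h2 := key ⟨fun t => (1, t), by fun_prop⟩ q.extend fun t => by
    simp [F, Path.extend, pr, Set.IccExtend]
  have h3 := key ⟨fun t => (t, 0), by fun_prop⟩ (.const ℝ u) fun t => by simp [F, hpr0]
  have h4 := key ⟨fun t => (t, 1), by fun_prop⟩ (.const ℝ u') fun t => by simp [F, hpr1]
  simp only [hsegI, hconst, ContinuousMap.coe_mk] at h1 h2 h3 h4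
  rw [h1, h2, inv_mul_eq_one.1 h3.symm, inv_mul_eq_one.1 h4.symm]

end PathHom

/-! ### Gluing simply connected open sets; spheres. -/

namespace Path.Homotopic

variable {X : Type*} [TopologicalSpace X]

theorem trans_cancel_left {x y z : X} {s : Path x y} {p q : Path y z}
    (h : (s.trans p).Homotopic (s.trans q)) : p.Homotopic q := by
  rw [← Quotient.eq] at h ⊢
  simp only [Quotient.mk_trans] at h
  have := congr_arg (Quotient.trans (Quotient.mk s).symm) h
  simpa [← Quotient.trans_assoc] using this

/-- Used with `e`, `e'` the tracks of a deformation, `R` the deformed path and `h` the naturality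
square: it replaces `P` by `R` at the cost of the connecting paths `r`, `r'`. -/
theorem Quotient.trans_eq_of_conj {w w' x y a b : X} {s : Homotopic.Quotient w x}
    {s' : Homotopic.Quotient w' y} {P : Homotopic.Quotient x y} {e : Homotopic.Quotient x a}
    {e' : Homotopic.Quotient y b} {R : Homotopic.Quotient a b} {r : Homotopic.Quotient w a}
    {r' : Homotopic.Quotient w' b} (hr : s.trans e = r) (hr' : s'.trans e' = r')
    (h : P.trans e' = e.trans R) : s.trans P = ((r.trans R).trans r'.symm).trans s' := by
  have hs' : s' = r'.trans e'.symm := by simp [← hr']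
  have hP : P = (e.trans R).trans e'.symm := by simp [← h]
  rw [hs', hP, ← hr]
  grind

theorem of_isSimplyConnected {U : Set X} (hU : IsSimplyConnected U) {x y : X} (p q : Path x y)
    (hp : ∀ t, p t ∈ U) (hq : ∀ t, q t ∈ U) : p.Homotopic q := by
  have := hU.simplyConnectedSpace
  exact (SimplyConnectedSpace.paths_homotopic (p.codRestrict hp) (q.codRestrict hq)).map
    ⟨Subtype.val, continuous_subtype_val⟩

end Path.Homotopic

/-- A path in `V` has both ends in `U ∩ V`; any path there with the same ends is homotopic to it
inside `V`. -/
theorem exists_homotopic_path_of_isSimplyConnected {X : Type*} [TopologicalSpace X] {U V : Set X}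
    (hV : IsSimplyConnected V) (hUV : IsPathConnected (U ∩ V)) {w x : X} (hw : w ∈ U ∩ V)
    (hx : x ∈ U) (s : Path w x) (hs : (∀ t, s t ∈ U) ∨ ∀ t, s t ∈ V) :
    ∃ s' : Path w x, (∀ t, s' t ∈ U) ∧ s.Homotopic s' := by
  rcases hs with hs | hs
  · exact ⟨s, hs, .refl s⟩
  · have hxV : x ∈ V := by simpa using hs 1
    obtain ⟨s', hs'⟩ := hUV.joinedIn w hw x ⟨hx, hxV⟩
    exact ⟨s', fun t => (hs' t).1, .of_isSimplyConnected hV _ _ hs fun t => (hs' t).2⟩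

/-- The union of two simply connected open sets with path connected intersection is simply
connected. -/
theorem simplyConnectedSpace_of_open_cover {X : Type*} [TopologicalSpace X] {U V : Set X}
    (hUo : IsOpen U) (hVo : IsOpen V) (hcover : ∀ x, x ∈ U ∨ x ∈ V) (hU : IsSimplyConnected U)
    (hV : IsSimplyConnected V) (hUV : IsPathConnected (U ∩ V)) : SimplyConnectedSpace X := by
  obtain ⟨w, hw⟩ := hUV.nonempty
  have hconn : ∀ x, ∃ s : Path w x, (∀ t, s t ∈ U) ∨ ∀ t, s t ∈ V := by
    intro x
    rcases hcover x with hx | hx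
    · obtain ⟨s, hs⟩ := hU.isPathConnected.joinedIn w hw.1 x hx
      exact ⟨s, .inl hs⟩
    · obtain ⟨s, hs⟩ := hV.isPathConnected.joinedIn w hw.2 x hx
      exact ⟨s, .inr hs⟩
  have hloc : ∀ {U V : Set X}, IsSimplyConnected U → IsSimplyConnected V →
      IsPathConnected (U ∩ V) → w ∈ U ∩ V → ∀ {x y : X} (p : Path x y), (∀ t, p t ∈ U) →
      ∀ (s : Path w x) (s' : Path w y), ((∀ t, s t ∈ U) ∨ ∀ t, s t ∈ V) →
        ((∀ t, s' t ∈ U) ∨ ∀ t, s' t ∈ V) → (s.trans p).Homotopic s' := by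
    intro U V hU hV hUV hw x y p hp s s' hs hs'
    obtain ⟨r, hr, hsr⟩ := exists_homotopic_path_of_isSimplyConnected hV hUV hw
      (by simpa using hp 0) s hs
    obtain ⟨r', hr', hsr'⟩ := exists_homotopic_path_of_isSimplyConnected hV hUV hw
      (by simpa using hp 1) s' hs'
    exact (hsr.hcomp (.refl p)).trans
      (.trans (.of_isSimplyConnected hU _ _ (Path.trans_mem hr hp) hr') hsr'.symm)
  -- Quantifying over all connecting paths makes the claim closed under concatenation. Afterwards
  -- two paths with the same ends are compared with the same `s'`.
  have key : ∀ {x y : X} (p : Path x y) (s : Path w x) (s' : Path w y),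
      ((∀ t, s t ∈ U) ∨ ∀ t, s t ∈ V) → ((∀ t, s' t ∈ U) ∨ ∀ t, s' t ∈ V) →
      (s.trans p).Homotopic s' := by
    intro x y p
    refine Path.forall_of_local (C := fun {x y} p => ∀ (s : Path w x) (s' : Path w y),
      ((∀ t, s t ∈ U) ∨ ∀ t, s t ∈ V) → ((∀ t, s' t ∈ U) ∨ ∀ t, s' t ∈ V) →
      (s.trans p).Homotopic s') ?_ ?_ ?_ p
    · intro x y p q hpq h s s' hs hs'
      exact ((Path.Homotopic.refl s).hcomp hpq.symm).trans (h s s' hs hs')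
    · intro x y z p q hp hq s s' hs hs'
      obtain ⟨r, hr⟩ := hconn y
      exact (Path.Homotopic.trans_assoc s p q).symm.trans
        (((hp s r hs hr).hcomp (.refl q)).trans (hq r s' hr hs'))
    · intro y
      rcases hcover y with hy | hy
      · exact ⟨U, hUo.mem_nhds hy, fun p hp s s' hs hs' => hloc hU hV hUV hw p hp s s' hs hs'⟩
      · exact ⟨V, hVo.mem_nhds hy, fun p hp s s' hs hs' => hloc hV hU
          (by rwa [Set.inter_comm]) hw.symm p hp s s' hs.symm hs'.symm⟩
  refine simply_connected_iff_paths_homotopic'.2 ⟨⟨⟨w⟩, fun x y => ?_⟩, fun {x y} p q => ?_⟩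
  · obtain ⟨s, -⟩ := hconn x
    obtain ⟨s', -⟩ := hconn y
    exact ⟨s.symm.trans s'⟩
  · obtain ⟨s, hs⟩ := hconn x
    obtain ⟨s', hs'⟩ := hconn y
    exact ((key p s s' hs hs').trans (key q s s' hs hs').symm).trans_cancel_left

/-- The unit sphere in a Euclidean space of dimension at least three is simply connected. -/
theorem simplyConnectedSpace_sphere {n : ℕ} (hn : 3 ≤ n) :
    SimplyConnectedSpace (sphere (0 : EuclideanSpace ℝ (Fin n)) 1) := by
  obtain ⟨m, rfl⟩ : ∃ m, n = m + 1 := ⟨n - 1, by omega⟩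
  have hfin : Module.finrank ℝ (EuclideanSpace ℝ (Fin (m + 1))) = m + 1 := by simp
  have : Fact (Module.finrank ℝ (EuclideanSpace ℝ (Fin (m + 1))) = m + 1) := ⟨hfin⟩
  let S := sphere (0 : EuclideanSpace ℝ (Fin (m + 1))) 1
  have hv : ∀ v : S, ‖(v : EuclideanSpace ℝ (Fin (m + 1)))‖ = 1 := fun v => by simp
  have hsc : ∀ v : S, IsSimplyConnected ({v}ᶜ : Set S) := by
    intro v
    rw [← range_stereographic_symm (hv v) v.2, ← Set.image_univ,
      (isOpenEmbedding_stereographic_symm (hv v)).isEmbedding.isSimplyConnected_image]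
    have : ContractibleSpace (Set.univ : Set (ℝ ∙ (v : EuclideanSpace ℝ (Fin (m + 1))))ᗮ) :=
      convex_univ.contractibleSpace Set.univ_nonempty
    exact SimplyConnectedSpace.ofContractible _
  obtain ⟨v⟩ : Nonempty S := (NormedSpace.sphere_nonempty.2 zero_le_one).to_subtype
  refine simplyConnectedSpace_of_open_cover (U := {v}ᶜ) (V := {-v}ᶜ) isOpen_compl_singleton
    isOpen_compl_singleton ?_ (hsc v) (hsc (-v)) ?_
  · intro x
    by_contra! h
    simp only [Set.mem_compl_iff, Set.mem_singleton_iff, not_not] at h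
    exact ne_neg_of_mem_unit_sphere ℝ v (h.1.symm.trans h.2)
  -- Stereographic projection from `v` sends `-v` to `0`, so the intersection is a punctured
  -- hyperplane of dimension `m ≥ 2`.
  · have hrank : 1 < Module.rank ℝ (ℝ ∙ (v : EuclideanSpace ℝ (Fin (m + 1))))ᗮ := by
      rw [← Module.finrank_eq_rank]
      have hf : Module.finrank ℝ (ℝ ∙ (v : EuclideanSpace ℝ (Fin (m + 1))))ᗮ = m :=
        Submodule.finrank_orthogonal_span_singleton (ne_zero_of_mem_unit_sphere v)
      rw [hf]
      exact_mod_cast (by omega : 1 < m)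
    have h0 := isPathConnected_compl_singleton_of_one_lt_rank hrank 0
    have himg := h0.image (isOpenEmbedding_stereographic_symm (hv v)).continuous
    rwa [Set.image_compl_eq_range_sdiff_image
        (isOpenEmbedding_stereographic_symm (hv v)).injective, range_stereographic_symm (hv v) v.2,
      Set.image_singleton, Set.sdiff_eq, ← stereographic_apply_neg v,
      (stereographic (hv v)).left_inv ?_] at himg
    rw [stereographic_source]
    intro h
    exact ne_neg_of_mem_unit_sphere ℝ v h.symm

/-! ### Handle attachments and the radial deformation off the cocores. -/

/-- The space `Y` is obtained from the closed subspace `i Z` by attaching disjoint copies of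
`D × B`, where `D` is the closed unit ball of `E`, along `∂D × B`. -/
structure HandleAttachment (E B Z Y ι : Type*) [NormedAddCommGroup E] [NormedSpace ℝ E]
    [TopologicalSpace B] [TopologicalSpace Z] [TopologicalSpace Y] where
  i : C(Z, Y)
  e : ι → C(closedBall (0 : E) 1 × B, Y)
  isClosedEmbedding_i : IsClosedEmbedding i
  isClosedEmbedding_e : ∀ a, IsClosedEmbedding (e a)
  disjoint : ∀ a b, a ≠ b → Disjoint (Set.range (e a)) (Set.range (e b))
  cover : ∀ y, y ∈ Set.range i ∨ ∃ a, y ∈ Set.range (e a)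
  mem_range_iff : ∀ a x b, e a (x, b) ∈ Set.range i ↔ ‖(x : E)‖ = 1

namespace HandleAttachment

variable {E B Z Y ι G : Type*} [NormedAddCommGroup E] [NormedSpace ℝ E]
  [TopologicalSpace B] [TopologicalSpace Z] [TopologicalSpace Y] [Group G]
  (A : HandleAttachment E B Z Y ι)

/-- The radial homotopy from the identity of the ball to the normalization. -/
noncomputable def push (t : I) (x : closedBall (0 : E) 1) : closedBall (0 : E) 1 :=
  -- Since `0⁻¹ = 0`, the formula is defined at the centre and fixes it; continuity is claimed only
  -- off the centre.
  ⟨((1 - t : ℝ) + t * ‖(x : E)‖⁻¹) • (x : E), by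
    have hx := mem_closedBall_zero_iff.1 x.2
    have ht0 := t.2.1
    have ht1 := t.2.2
    rw [mem_closedBall_zero_iff, norm_smul, Real.norm_of_nonneg (by
      have : (0 : ℝ) ≤ 1 - t := by linarith
      positivity), add_mul]
    have h1 : (1 - t : ℝ) * ‖(x : E)‖ ≤ 1 - t := mul_le_of_le_one_right (by linarith) hx
    have h2 : (t : ℝ) * ‖(x : E)‖⁻¹ * ‖(x : E)‖ ≤ t := by
      rw [mul_assoc]
      exact mul_le_of_le_one_right ht0 (inv_mul_le_one)
    linarith⟩

theorem push_zero (x : closedBall (0 : E) 1) : push 0 x = x := by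
  ext; simp [push]

theorem push_of_norm_eq_one (t : I) {x : closedBall (0 : E) 1} (hx : ‖(x : E)‖ = 1) :
    push t x = x := by
  ext; simp [push, hx]

theorem norm_push_one {x : closedBall (0 : E) 1} (hx : (x : E) ≠ 0) :
    ‖(push 1 x : E)‖ = 1 := by
  simp [push, norm_smul, hx]

theorem continuousOn_push :
    ContinuousOn (fun p : I × closedBall (0 : E) 1 => push p.1 p.2) {p | (p.2 : E) ≠ 0} := by
  rw [continuousOn_iff_continuous_domRestrict]
  refine Continuous.subtype_mk (Continuous.smul (Continuous.add (by fun_prop)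
    (Continuous.mul (by fun_prop) (Continuous.inv₀ (by fun_prop) ?_))) (by fun_prop)) _
  rintro ⟨p, hp⟩
  simpa using hp

/-- The union of the cores `0 × B` of the cocores. -/
def core : Set Y := {y | ∃ (a : ι) (x : closedBall (0 : E) 1) (b : B),
  (x : E) = 0 ∧ A.e a (x, b) = y}

/-- The open handle. -/
def openHandle (a : ι) : Set Y := {y | ∃ (x : closedBall (0 : E) 1) (b : B),
  ‖(x : E)‖ < 1 ∧ A.e a (x, b) = y}

theorem e_eq_iff {a a' : ι} {p p' : closedBall (0 : E) 1 × B} :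
    A.e a p = A.e a' p' ↔ a = a' ∧ p = p' := by
  constructor
  · intro h
    by_cases ha : a = a'
    · subst ha
      exact ⟨rfl, (A.isClosedEmbedding_e a).injective h⟩
    · exact (Set.disjoint_left.1 (A.disjoint a a' ha) ⟨p, rfl⟩ ⟨p', h.symm⟩).elim
  · rintro ⟨rfl, rfl⟩
    rfl

theorem isOpen_openHandle [Finite ι] (a : ι) : IsOpen (A.openHandle a) := by
  have : A.openHandle a = (Set.range A.i ∪ ⋃ b : {b // b ≠ a}, Set.range (A.e b))ᶜ := by
    ext y
    simp only [openHandle, Set.mem_ofPred_eq, Set.compl_union, Set.mem_inter_iff, Set.mem_compl_iff,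
      Set.mem_iUnion, not_exists]
    constructor
    · rintro ⟨x, b, hx, rfl⟩
      rw [A.mem_range_iff]
      refine ⟨hx.ne, ?_⟩
      rintro ⟨c, hc⟩ ⟨p, hp⟩
      exact hc (A.e_eq_iff.1 hp).1
    · rintro ⟨hy, hy'⟩
      obtain ⟨c, ⟨x, b⟩, rfl⟩ := (A.cover y).resolve_left hy
      obtain rfl : c = a := by
        by_contra hc
        exact hy' ⟨c, hc⟩ ⟨_, rfl⟩
      rw [A.mem_range_iff] at hy
      exact ⟨x, b, lt_of_le_of_ne (mem_closedBall_zero_iff.1 x.2) hy, rfl⟩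
  rw [this]
  exact (A.isClosedEmbedding_i.isClosed_range.union
    (isClosed_iUnion_of_finite fun b : {b // b ≠ a} =>
      (A.isClosedEmbedding_e b).isClosed_range)).isOpen_compl

theorem isClosed_core [Finite ι] : IsClosed A.core := by
  have : A.core = ⋃ a, A.e a '' {p | (p.1 : E) = 0} := by
    ext y
    simp only [core, Set.mem_ofPred_eq, Set.mem_iUnion, Set.mem_image, Prod.exists]
  rw [this]
  refine isClosed_iUnion_of_finite fun a => (A.isClosedEmbedding_e a).isClosedMap _ ?_
  exact isClosed_eq (by fun_prop) continuous_const

theorem i_notMem_core (z : Z) : A.i z ∉ A.core := by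
  rintro ⟨a, x, b, hx, h⟩
  have := (A.mem_range_iff a x b).1 ⟨z, h.symm⟩
  simp [hx] at this

theorem e_notMem_core {a : ι} {x : closedBall (0 : E) 1} {b : B} :
    A.e a (x, b) ∉ A.core ↔ (x : E) ≠ 0 := by
  rw [not_iff_not]
  constructor
  · rintro ⟨a', x', b', hx, h⟩
    obtain ⟨-, h⟩ := A.e_eq_iff.1 h
    simp only [Prod.mk.injEq] at h
    rwa [← h.1]
  · exact fun hx => ⟨a, x, b, hx, rfl⟩

/-- The two prescriptions are compatible because `push` fixes the unit sphere, where a handle meets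
`Z`, and different handles are disjoint. -/
theorem exists_deform (t : I) (y : Y) : ∃ y', (y ∈ Set.range A.i → y' = y) ∧
    ∀ a x b, A.e a (x, b) = y → y' = A.e a (push t x, b) := by
  by_cases hy : y ∈ Set.range A.i
  · refine ⟨y, fun _ => rfl, ?_⟩
    rintro a x b rfl
    rw [push_of_norm_eq_one t ((A.mem_range_iff a x b).1 hy)]
  · obtain ⟨a, ⟨x, b⟩, rfl⟩ := (A.cover y).resolve_left hy
    refine ⟨A.e a (push t x, b), fun h => (hy h).elim, fun a' x' b' h => ?_⟩
    obtain ⟨rfl, h'⟩ := A.e_eq_iff.1 h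
    obtain ⟨rfl, rfl⟩ := Prod.mk.inj h'
    rfl

/-- The radial deformation of the complement of the core. -/
noncomputable def deform (t : I) (y : Y) : Y := (A.exists_deform t y).choose

theorem deform_i (t : I) (z : Z) : A.deform t (A.i z) = A.i z :=
  (A.exists_deform t _).choose_spec.1 ⟨z, rfl⟩

theorem deform_e (t : I) (a : ι) (x : closedBall (0 : E) 1) (b : B) :
    A.deform t (A.e a (x, b)) = A.e a (push t x, b) :=
  (A.exists_deform t _).choose_spec.2 a x b rfl

theorem deform_zero (y : Y) : A.deform 0 y = y := by
  rcases A.cover y with ⟨z, rfl⟩ | ⟨a, ⟨x, b⟩, rfl⟩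
  · exact A.deform_i 0 z
  · rw [A.deform_e, push_zero]

theorem deform_one_mem {y : Y} (hy : y ∉ A.core) : A.deform 1 y ∈ Set.range A.i := by
  rcases A.cover y with ⟨z, rfl⟩ | ⟨a, ⟨x, b⟩, rfl⟩
  · exact ⟨z, (A.deform_i 1 z).symm⟩
  · rw [A.deform_e, A.mem_range_iff]
    exact norm_push_one (A.e_notMem_core.1 hy)

/-- Gluing over the finite closed cover by `Z` and the handles; on a handle the embedding transports
the continuity of `push` off the centre. -/
theorem continuous_deform [Finite ι] :
    Continuous fun p : I × (A.coreᶜ : Set Y) => A.deform p.1 p.2 := by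
  let S : Option ι → Set (I × (A.coreᶜ : Set Y)) := fun o =>
    o.elim {p | (p.2 : Y) ∈ Set.range A.i} fun a => {p | (p.2 : Y) ∈ Set.range (A.e a)}
  have hval : Continuous fun p : I × (A.coreᶜ : Set Y) => (p.2 : Y) := by fun_prop
  refine (locallyFinite_of_finite S).continuous ?_ ?_ ?_
  · refine Set.eq_univ_of_forall fun p => Set.mem_iUnion.2 ?_
    rcases A.cover p.2 with h | ⟨a, h⟩
    · exact ⟨none, h⟩
    · exact ⟨some a, h⟩
  · rintro (_ | a)
    · exact A.isClosedEmbedding_i.isClosed_range.preimage hval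
    · exact (A.isClosedEmbedding_e a).isClosed_range.preimage hval
  · rintro (_ | a)
    · refine hval.continuousOn.congr ?_
      rintro ⟨t, y, hy⟩ ⟨z, hz⟩
      simp only at hz ⊢
      rw [← hz, A.deform_i]
    · rw [continuousOn_iff_continuous_domRestrict]
      let h := (A.isClosedEmbedding_e a).isEmbedding.toHomeomorph
      let inv : S (some a) → closedBall (0 : E) 1 × B := fun p => h.symm ⟨p.1.2, p.2⟩
      have hinv : Continuous inv := h.symm.continuous.comp (by fun_prop)
      have he : ∀ p, A.e a (inv p) = p.1.2 := fun p =>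
        congr_arg Subtype.val (h.apply_symm_apply ⟨(p.1.2 : Y), p.2⟩)
      have hne : ∀ p, ((inv p).1 : E) ≠ 0 := by
        intro p
        have := p.1.2.2
        rw [← he p] at this
        exact A.e_notMem_core.1 this
      have hpush : Continuous fun p : S (some a) => push p.1.1 (inv p).1 :=
        continuousOn_push.comp_continuous (f := fun p : S (some a) => (p.1.1, (inv p).1))
           (by fun_prop) hne
      have : Continuous fun p : S (some a) => A.e a (push p.1.1 (inv p).1, (inv p).2) := by
        fun_prop
      refine this.congr fun p => ?_
      rw [← A.deform_e, Prod.mk.eta, he]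
      rfl

/-- The retraction of the complement of the core. -/
noncomputable def ret [Finite ι] : C((A.coreᶜ : Set Y), Z) where
  toFun u := (A.deform_one_mem u.2).choose
  continuous_toFun := by
    rw [A.isClosedEmbedding_i.isEmbedding.continuous_iff]
    have h := A.continuous_deform.comp
      (Continuous.prodMk_right (1 : I) : Continuous fun u : (A.coreᶜ : Set Y) => ((1 : I), u))
    exact h.congr fun u => (A.deform_one_mem u.2).choose_spec.symm

theorem i_ret [Finite ι] (u : (A.coreᶜ : Set Y)) : A.i (A.ret u) = A.deform 1 u :=
  (A.deform_one_mem u.2).choose_spec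

theorem ret_i [Finite ι] (u : (A.coreᶜ : Set Y)) (z : Z) (h : A.i z = u) : A.ret u = z := by
  apply A.isClosedEmbedding_i.injective
  rw [A.i_ret, ← h, A.deform_i]

/-- The deformation of the complement of the core to `Z`. -/
noncomputable def homotopy [Finite ι] :
    (⟨Subtype.val, continuous_subtype_val⟩ : C((A.coreᶜ : Set Y), Y)).Homotopy
      (A.i.comp A.ret) where
  toFun p := A.deform p.1 p.2
  continuous_toFun := A.continuous_deform
  map_zero_left u := A.deform_zero u
  map_one_left u := (A.i_ret u).symm

/-- The attaching map. -/
noncomputable def att (a : ι) : C(sphere (0 : E) 1 × B, Z) where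
  toFun p := ((A.mem_range_iff a ⟨p.1, sphere_subset_closedBall p.1.2⟩ p.2).2
    (by simp)).choose
  continuous_toFun := by
    rw [A.isClosedEmbedding_i.isEmbedding.continuous_iff]
    have : Continuous fun p : sphere (0 : E) 1 × B =>
        A.e a (⟨p.1, sphere_subset_closedBall p.1.2⟩, p.2) := by fun_prop
    exact this.congr fun p => ((A.mem_range_iff a ⟨p.1, sphere_subset_closedBall p.1.2⟩ p.2).2
      (by simp)).choose_spec.symm

theorem i_att (a : ι) (p : sphere (0 : E) 1 × B) :
    A.i (A.att a p) = A.e a (⟨p.1, sphere_subset_closedBall p.1.2⟩, p.2) :=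
  ((A.mem_range_iff a ⟨p.1, sphere_subset_closedBall p.1.2⟩ p.2).2 (by simp)).choose_spec

/-- Lift a path in the image of a handle to the handle. -/
theorem exists_lift (a : ι) {y y' : Y} (γ : Path y y') (h : ∀ t, γ t ∈ Set.range (A.e a)) :
    ∃ (p p' : closedBall (0 : E) 1 × B) (δ : Path p p'), ∀ t, A.e a (δ t) = γ t := by
  let η := (A.isClosedEmbedding_e a).isEmbedding.toHomeomorph
  have hη : ∀ t, A.e a (η.symm ⟨γ t, h t⟩) = γ t := fun t =>
    congr_arg Subtype.val (η.apply_symm_apply ⟨γ t, h t⟩)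
  have hcont : Continuous fun t => η.symm ⟨γ t, h t⟩ := η.symm.continuous.comp (by fun_prop)
  exact ⟨_, _, ⟨⟨_, hcont⟩, rfl, rfl⟩, hη⟩

/-- A path in a handle with ends in `Z` can be pushed into `Z`. -/
theorem exists_path_of_mem_range_e (hE : 1 < Module.rank ℝ E) (a : ι) {z z' : Z}
    (γ : Path (A.i z) (A.i z')) (h : ∀ t, γ t ∈ Set.range (A.e a)) :
    ∃ r : Path z z', γ.Homotopic (r.map A.i.continuous) := by
  obtain ⟨⟨x, b⟩, ⟨x', b'⟩, δ, hδ⟩ := A.exists_lift a γ h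
  have h0 : A.e a (x, b) = A.i z := by simpa using hδ 0
  have h1 : A.e a (x', b') = A.i z' := by simpa using hδ 1
  have hx : (x : E) ∈ sphere (0 : E) 1 := by
    simpa using (A.mem_range_iff a x b).1 ⟨z, h0.symm⟩
  have hx' : (x' : E) ∈ sphere (0 : E) 1 := by
    simpa using (A.mem_range_iff a x' b').1 ⟨z', h1.symm⟩
  -- The `B`-coordinate of the lifted path is kept and the ball coordinate is replaced by a path in
  -- the sphere, connected by `hE`; contractibility of the ball gives the homotopy.
  obtain ⟨ρ, hρ⟩ := (isPathConnected_sphere hE 0 zero_le_one).joinedIn _ hx _ hx'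
  have hz : A.att a (⟨x, hx⟩, b) = z := A.isClosedEmbedding_i.injective (by rw [i_att, ← h0])
  have hz' : A.att a (⟨x', hx'⟩, b') = z' := A.isClosedEmbedding_i.injective (by rw [i_att, ← h1])
  subst hz hz'
  let δ₂ : Path b b' := δ.map continuous_snd
  let δ₁ : Path x x' := δ.map continuous_fst
  let ρ' : Path (⟨x, hx⟩ : sphere (0 : E) 1) ⟨x', hx'⟩ := ρ.codRestrict hρ
  refine ⟨(ρ'.prod δ₂).map (A.att a).continuous, ?_⟩
  let ρ'' : Path x x' := ρ.codRestrict fun t => sphere_subset_closedBall (hρ t)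
  have : ContractibleSpace (closedBall (0 : E) 1) :=
    (convex_closedBall _ _).contractibleSpace ⟨0, by simp⟩
  obtain ⟨H⟩ := SimplyConnectedSpace.paths_homotopic δ₁ ρ''
  have := (Path.Homotopic.map ⟨Path.Homotopic.prodHomotopy H (.refl δ₂)⟩ (A.e a)).pathCast
    h0.symm h1.symm
  convert this using 1
  · ext t
    exact (hδ t).symm
  · ext t
    exact A.i_att a _

end HandleAttachment

/-! ### Effect of a handle attachment on paths. -/

namespace HandleAttachment

variable {E B Z Y ι G : Type*} [NormedAddCommGroup E] [NormedSpace ℝ E]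
  [TopologicalSpace B] [TopologicalSpace Z] [TopologicalSpace Y] [Group G]
  (A : HandleAttachment E B Z Y ι)

/-- A path is short if it is constant or contained in a single handle. -/
def IsShort {y y' : Y} (s : Path y y') : Prop :=
  (∀ t, s t = y) ∨ ∃ a, ∀ t, s t ∈ Set.range (A.e a)

theorem exists_isShort (hE : 1 < Module.rank ℝ E) (y : Y) :
    ∃ (z : Z) (s : Path (A.i z) y), A.IsShort s := by
  rcases A.cover y with ⟨z, rfl⟩ | ⟨a, ⟨x, b⟩, rfl⟩
  · exact ⟨z, Path.refl _, .inl fun _ => rfl⟩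
  · obtain ⟨v, hv⟩ := (isPathConnected_sphere hE 0 zero_le_one).nonempty
    have : ContractibleSpace (closedBall (0 : E) 1) :=
      (convex_closedBall _ _).contractibleSpace ⟨0, by simp⟩
    let ρ : Path (⟨v, sphere_subset_closedBall hv⟩ : closedBall (0 : E) 1) x :=
      PathConnectedSpace.somePath _ _
    refine ⟨A.att a (⟨v, hv⟩, b), ((ρ.prod (Path.refl b)).map (A.e a).continuous).cast
      (A.i_att a _) rfl, .inr ⟨a, fun t => ⟨_, rfl⟩⟩⟩

theorem exists_path_of_isShort (hE : 1 < Module.rank ℝ E) {z z' : Z}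
    (s : Path (A.i z) (A.i z')) (hs : A.IsShort s) :
    ∃ r : Path z z', s.Homotopic (r.map A.i.continuous) := by
  rcases hs with hs | ⟨a, hs⟩
  · have : z' = z := A.isClosedEmbedding_i.injective (by simpa using hs 1)
    subst this
    refine ⟨Path.refl _, ?_⟩
    convert Path.Homotopic.refl _
    ext t
    exact (hs t).symm
  · exact A.exists_path_of_mem_range_e hE a s hs

variable [Finite ι]

/-- Following a short path by the deformation track of its end gives a short path again, now with
both ends in `Z`. -/
theorem exists_path_of_mem_compl_core (hE : 1 < Module.rank ℝ E) {z : Z}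
    (u : (A.coreᶜ : Set Y)) (s : Path (A.i z) u) (hs : A.IsShort s) :
    ∃ r : Path z (A.ret u),
      (s.trans (A.homotopy.evalAt u)).Homotopic (r.map A.i.continuous) := by
  apply A.exists_path_of_isShort hE
  rcases hs with hs | ⟨a, hs⟩
  · left
    intro t
    have hu : A.i z = u := by simpa using (hs 1).symm
    rw [Path.trans_apply]
    split_ifs
    · exact hs _
    · change A.deform _ u = A.i z
      rw [← hu, A.deform_i]
  · right
    refine ⟨a, fun t => ?_⟩
    obtain ⟨⟨x, b⟩, hu⟩ : (u : Y) ∈ Set.range (A.e a) := by simpa using hs 1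
    rw [Path.trans_apply]
    split_ifs
    · exact hs _
    · change A.deform _ u ∈ _
      rw [← hu, A.deform_e]
      exact ⟨_, rfl⟩

/-- If `dim E ≥ 2`, every path in `Y` with ends in `Z` can be pushed into `Z`. -/
theorem exists_path_homotopic_map (hE : 1 < Module.rank ℝ E) {z z' : Z}
    (γ : Path (A.i z) (A.i z')) : ∃ r : Path z z', γ.Homotopic (r.map A.i.continuous) := by
  have key : ∀ {x y : Y} (p : Path x y) {z z' : Z} (s : Path (A.i z) x) (s' : Path (A.i z') y),
      A.IsShort s → A.IsShort s' →
        ∃ r : Path z z', (s.trans p).Homotopic ((r.map A.i.continuous).trans s') := by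
    intro x y p
    refine Path.forall_of_local (C := fun {x y} p => ∀ {z z' : Z} (s : Path (A.i z) x)
      (s' : Path (A.i z') y), A.IsShort s → A.IsShort s' →
        ∃ r : Path z z', (s.trans p).Homotopic ((r.map A.i.continuous).trans s')) ?_ ?_ ?_ p
    · intro x y p q hpq h z z' s s' hs hs'
      obtain ⟨r, hr⟩ := h s s' hs hs'
      exact ⟨r, ((Path.Homotopic.refl s).hcomp hpq.symm).trans hr⟩
    · intro x y w p q hp hq z z' s s' hs hs'
      obtain ⟨z'', s'', hs''⟩ := A.exists_isShort hE y
      obtain ⟨r, hr⟩ := hp s s'' hs hs''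
      obtain ⟨r', hr'⟩ := hq s'' s' hs'' hs'
      refine ⟨r.trans r', ?_⟩
      rw [Path.map_trans]
      exact (Path.Homotopic.trans_assoc s p q).symm.trans
        ((hr.hcomp (.refl q)).trans ((Path.Homotopic.trans_assoc _ _ _).trans
          (((Path.Homotopic.refl _).hcomp hr').trans (Path.Homotopic.trans_assoc _ _ _).symm)))
    · intro y
      by_cases hy : y ∈ A.core
      · obtain ⟨a, x, b, hx, rfl⟩ := hy
        refine ⟨A.openHandle a, (A.isOpen_openHandle a).mem_nhds
          ⟨x, b, by simp [hx], rfl⟩, ?_⟩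
        -- An open handle misses `Z` and the other handles, so a short path ending there runs in
        -- that handle, and `s p s'⁻¹` can be pushed into `Z` at once.
        have hopen : ∀ {y : Y} {z : Z} (s : Path (A.i z) y), A.IsShort s → y ∈ A.openHandle a →
            ∀ t, s t ∈ Set.range (A.e a) := by
          rintro y z s hs ⟨x, b, hx, rfl⟩ t
          rcases hs with hs | ⟨c, hs⟩
          · have h1 : A.e a (x, b) = A.i z := by simpa using hs 1
            have := (A.mem_range_iff a x b).1 ⟨z, h1.symm⟩
            exact (hx.ne this).elim
          · obtain ⟨p, hp⟩ : A.e a (x, b) ∈ Set.range (A.e c) := by simpa using hs 1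
            obtain ⟨rfl, -⟩ := A.e_eq_iff.1 hp
            exact hs t
        intro x x' p hp z z' s s' hs hs'
        have h1 := hopen s hs (by simpa using hp 0)
        have h2 := hopen s' hs' (by simpa using hp 1)
        obtain ⟨r, hr⟩ := A.exists_path_of_mem_range_e hE a ((s.trans p).trans s'.symm)
          (Path.trans_mem (Path.trans_mem h1 fun t => by
            obtain ⟨x, b, -, h⟩ := hp t
            exact ⟨_, h⟩) fun t => h2 _)
        refine ⟨r, ?_⟩
        rw [← Path.Homotopic.Quotient.eq] at hr ⊢
        simp only [Path.Homotopic.Quotient.mk_trans, Path.Homotopic.Quotient.mk_symm] at hr ⊢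
        rw [← hr]
        simp
      · refine ⟨A.coreᶜ, A.isClosed_core.isOpen_compl.mem_nhds hy, ?_⟩
        intro x x' p hp z z' s s' hs hs'
        let p' := p.codRestrict hp
        obtain ⟨r, hr⟩ := A.exists_path_of_mem_compl_core hE ⟨x, by simpa using hp 0⟩ s hs
        obtain ⟨r', hr'⟩ := A.exists_path_of_mem_compl_core hE ⟨x', by simpa using hp 1⟩ s' hs'
        refine ⟨(r.trans (p'.map A.ret.continuous)).trans r'.symm, ?_⟩
        have hnat := Path.Homotopic.map_trans_evalAt A.homotopy p'
        rw [← Path.Homotopic.Quotient.eq] at hr hr' hnat ⊢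
        simp only [Path.map_trans, Path.Homotopic.Quotient.mk_trans, ← Path.map_symm,
          Path.Homotopic.Quotient.mk_symm] at hr hr' hnat ⊢
        exact Path.Homotopic.Quotient.trans_eq_of_conj hr hr' hnat
  obtain ⟨r, hr⟩ := key γ (Path.refl _) (Path.refl _) (.inl fun _ => rfl) (.inl fun _ => rfl)
  exact ⟨r, (Path.Homotopic.refl_trans γ).symm.trans (hr.trans (Path.Homotopic.trans_refl _))⟩

open Classical in
/-- A functor on the fundamental groupoid of `Z` which is trivial on the attaching regions
takes the same value on paths in `Z` which are homotopic in `Y`. -/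
theorem val_eq_of_homotopic_map [PathConnectedSpace (sphere (0 : E) 1 × B)] (Φ : PathHom Z G)
    (hΦ : ∀ a w (p : Path w w), Φ.val (p.map (A.att a).continuous) = 1) {z z' : Z}
    (p q : Path z z') (h : (p.map A.i.continuous).Homotopic (q.map A.i.continuous)) :
    Φ.val p = Φ.val q := by
  obtain ⟨w₀⟩ : Nonempty (sphere (0 : E) 1 × B) := inferInstance
  -- As `Φ` is trivial on loops in the attaching region, its values there are differences of a
  -- potential `g a`.
  let g : ι → sphere (0 : E) 1 × B → G := fun a w =>
    Φ.val ((PathConnectedSpace.somePath w₀ w).map (A.att a).continuous)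
  have hg : ∀ a {w w'} (p : Path w w'),
      Φ.val (p.map (A.att a).continuous) = (g a w)⁻¹ * g a w' := by
    intro a w w' p
    have := hΦ a w₀ (((PathConnectedSpace.somePath w₀ w).trans p).trans
      (PathConnectedSpace.somePath w₀ w').symm)
    rw [Path.map_trans, Path.map_trans, Φ.trans, Φ.trans, ← Path.map_symm, Φ.val_symm,
      mul_inv_eq_one] at this
    rw [eq_inv_mul_iff_mul_eq]
    exact this
  -- The potential is extended radially over the handle minus its cocore; the value 1 elsewhere is
  -- irrelevant.
  obtain ⟨f, hf⟩ : ∃ f : Y → G, ∀ a (x : closedBall (0 : E) 1) b (hx : (x : E) ≠ 0),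
      f (A.e a (x, b)) = g a (⟨push 1 x, by simpa using norm_push_one hx⟩, b) := by
    let P : Y → G → Prop := fun y v => ∃ (a : ι) (x : closedBall (0 : E) 1) (b : B),
      ∃ hx : (x : E) ≠ 0, A.e a (x, b) = y ∧
      v = g a (⟨push 1 x, by simpa using norm_push_one hx⟩, b)
    refine ⟨fun y => if h : ∃ v, P y v then h.choose else 1, fun a x b hx => ?_⟩
    have h : ∃ v, P (A.e a (x, b)) v := ⟨_, a, x, b, hx, rfl, rfl⟩
    beta_reduce
    rw [dif_pos h]
    obtain ⟨a', x', b', hx', heq, hv⟩ := h.choose_spec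
    rw [hv]
    obtain ⟨rfl, h'⟩ := A.e_eq_iff.1 heq
    obtain ⟨rfl, rfl⟩ := Prod.mk.inj h'
    rfl
  have hcollar : ∀ y ∉ A.coreᶜ, ∃ W ∈ 𝓝 y, ∀ {u u' : (A.coreᶜ : Set Y)} (p : Path u u'),
      (∀ t, (p t : Y) ∈ W) → (Φ.comp A.ret).val p = (f u)⁻¹ * f u' := by
    intro y hy
    rw [Set.notMem_compl_iff] at hy
    obtain ⟨a, x, b, hx, rfl⟩ := hy
    refine ⟨A.openHandle a, (A.isOpen_openHandle a).mem_nhds ⟨x, b, by simp [hx], rfl⟩, ?_⟩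
    intro u u' p hp
    obtain ⟨⟨x, b⟩, ⟨x', b'⟩, δ, hδ⟩ := A.exists_lift a (p.map continuous_subtype_val) fun t => by
      obtain ⟨x, b, -, h⟩ := hp t
      exact ⟨_, h⟩
    have hne : ∀ t, ((δ t).1 : E) ≠ 0 := fun t => by
      have := (p t).2
      rw [← A.e_notMem_core (a := a) (b := (δ t).2), Prod.mk.eta, hδ]
      exact this
    have hx : (x : E) ≠ 0 := by simpa using hne 0
    have hx' : (x' : E) ≠ 0 := by simpa using hne 1
    have hu : A.e a (x, b) = u := by simpa using hδ 0
    have hu' : A.e a (x', b') = u' := by simpa using hδ 1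
    have hpush : Continuous fun t => push 1 (δ t).1 :=
      continuousOn_push.comp_continuous (f := fun t : I => ((1 : I), (δ t).1)) (by fun_prop) hne
    let δ' : Path ((⟨push 1 x, by simpa using norm_push_one hx⟩, b) : sphere (0 : E) 1 × B)
        (⟨push 1 x', by simpa using norm_push_one hx'⟩, b') :=
      { toFun := fun t => (⟨push 1 (δ t).1, by simpa using norm_push_one (hne t)⟩, (δ t).2)
        continuous_toFun :=
          ((continuous_subtype_val.comp hpush).subtype_mk fun t => by
            simpa using norm_push_one (hne t)).prodMk (by fun_prop)
        source' := by simp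
        target' := by simp }
    rw [← hu, ← hu', hf a x b hx, hf a x' b' hx', ← hg a δ']
    refine Φ.val_ext fun t => A.isClosedEmbedding_i.injective ?_
    change A.i (A.ret (p t)) = A.i (A.att a (δ' t))
    rw [A.i_ret, A.i_att, ← show A.e a (δ t) = p t from hδ t]
    exact A.deform_e _ _ _ _
  let j : C(Z, (A.coreᶜ : Set Y)) := ⟨fun z => ⟨A.i z, A.i_notMem_core z⟩, by fun_prop⟩
  -- `Φ.comp A.ret` extends `Φ` to the complement of the cocores and has the potential `f` near
  -- them.
  have := PathHom.val_eq_of_homotopic_map_val A.isClosed_core.isOpen_compl (Φ.comp A.ret) f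
    hcollar (p.map j.continuous) (q.map j.continuous) h
  have hj : ∀ {z z' : Z} (r : Path z z'), (Φ.comp A.ret).val (r.map j.continuous) = Φ.val r :=
    fun r => Φ.val_ext fun t => A.ret_i _ _ rfl
  rwa [hj, hj] at this

end HandleAttachment

/-! ### Path functors from homomorphisms of fundamental groups. -/

open Classical in
/-- The functor to `G` induced by a homomorphism from the fundamental group at `q`; it is trivial
outside the path component of `q`. -/
noncomputable def PathHom.ofFundamentalGroup {X G : Type*} [TopologicalSpace X] [Group G] {q : X}
    (φ : FundamentalGroup X q →* G) : PathHom X G where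
  -- Products in `FundamentalGroup` are concatenations in reverse order; the inverse restores the
  -- order demanded by `PathHom`.
  val {x y} p := if h : Joined q x then
    (φ (FundamentalGroup.fromPath (Path.Homotopic.Quotient.mk
      ((h.somePath.trans p).trans (h.trans ⟨p⟩).somePath.symm))))⁻¹ else 1
  homotopic {x y p p'} hp := by
    split_ifs with h
    · congr 3
      exact Path.Homotopic.Quotient.eq.2 (((Path.Homotopic.refl _).hcomp hp).hcomp (.refl _))
    · rfl
  trans {x y z} p p' := by
    by_cases h : Joined q x
    · have h' : Joined q y := h.trans ⟨p⟩
      rw [dif_pos h, dif_pos h, dif_pos h', ← mul_inv_rev, ← map_mul]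
      congr 2
      change Path.Homotopic.Quotient.mk _ =
        (Path.Homotopic.Quotient.mk _).trans (Path.Homotopic.Quotient.mk _)
      simp only [Path.Homotopic.Quotient.mk_trans, Path.Homotopic.Quotient.mk_symm]
      grind
    · have h' : ¬ Joined q y := fun h' => h (h'.trans ⟨p.symm⟩)
      rw [dif_neg h, dif_neg h, dif_neg h', one_mul]

namespace PathHom

variable {X G : Type*} [TopologicalSpace X] [Group G] {q : X} (φ : FundamentalGroup X q →* G)

theorem ofFundamentalGroup_val_of_not_joined {x y : X} (p : Path x y) (h : ¬ Joined q x) :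
    (ofFundamentalGroup φ).val p = 1 := dif_neg h

/-- The chosen path from `q` to itself need not be constant, so the value is `φ` of the loop only up
to conjugation and inversion. Triviality is unaffected. -/
theorem ofFundamentalGroup_val_eq_one_iff (p : Path q q) :
    (ofFundamentalGroup φ).val p = 1 ↔
      φ (FundamentalGroup.fromPath (Path.Homotopic.Quotient.mk p)) = 1 := by
  have h : Joined q q := Joined.refl q
  let c : FundamentalGroup X q := FundamentalGroup.fromPath (Path.Homotopic.Quotient.mk h.somePath)
  let g : FundamentalGroup X q := FundamentalGroup.fromPath (Path.Homotopic.Quotient.mk p)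
  have hval : (ofFundamentalGroup φ).val p = (φ (c⁻¹ * (g * c)))⁻¹ := by
    have : (ofFundamentalGroup φ).val p = _ := dif_pos h
    rw [this]
    rfl
  rw [hval, inv_eq_one, map_mul, map_mul, map_inv, inv_mul_eq_one, right_eq_mul]

end PathHom

/-! ### Handles with cores of dimension at least three, and handles inside a Hausdorff space. -/

namespace HandleAttachment

/-- If `dim E ≥ 3` and paths in `Y` with the same ends are homotopic, then the same holds
for `Z`. -/
theorem homotopic_of_forall_homotopic {n : ℕ} (hn : 3 ≤ n) {B Z Y ι : Type*}
    [TopologicalSpace B] [TopologicalSpace Z] [TopologicalSpace Y] [Finite ι]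
    [SimplyConnectedSpace B] (A : HandleAttachment (EuclideanSpace ℝ (Fin n)) B Z Y ι)
    (hY : ∀ {y y' : Y} (p q : Path y y'), p.Homotopic q) {z z' : Z} (p q : Path z z') :
    p.Homotopic q := by
  have := simplyConnectedSpace_sphere hn
  have hloop : ∀ (w : sphere (0 : EuclideanSpace ℝ (Fin n)) 1 × B) (p : Path w w),
      p.Homotopic (Path.refl w) := fun w p =>
    ⟨Path.Homotopic.prodHomotopy
      (SimplyConnectedSpace.paths_homotopic (p.map continuous_fst) (Path.refl w.1)).some
      (SimplyConnectedSpace.paths_homotopic (p.map continuous_snd) (Path.refl w.2)).some⟩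
  have : PathConnectedSpace (sphere (0 : EuclideanSpace ℝ (Fin n)) 1 × B) := inferInstance
  -- The identity homomorphism detects every loop at `z`; the condition on the attaching regions is
  -- automatic because `S^(n-1) × B` is simply connected.
  let Φ := PathHom.ofFundamentalGroup (MonoidHom.id (FundamentalGroup Z z))
  have h := A.val_eq_of_homotopic_map Φ (fun a w p => by
    rw [Φ.homotopic ((hloop w p).map (A.att a))]
    exact Φ.val_refl _) (p.trans q.symm) (Path.refl z) (hY _ _)
  rw [Φ.val_refl, PathHom.ofFundamentalGroup_val_eq_one_iff] at h
  have h' : Path.Homotopic.Quotient.mk (p.trans q.symm) =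
    Path.Homotopic.Quotient.refl z := h
  rw [← Path.Homotopic.Quotient.eq]
  simp only [Path.Homotopic.Quotient.mk_trans, Path.Homotopic.Quotient.mk_symm] at h'
  calc Path.Homotopic.Quotient.mk p
      = ((Path.Homotopic.Quotient.mk p).trans (Path.Homotopic.Quotient.mk q).symm).trans
          (Path.Homotopic.Quotient.mk q) := by simp
    _ = Path.Homotopic.Quotient.mk q := by rw [h']; simp

/-- Attachments of handles inside a Hausdorff space. -/
noncomputable def ofSubsets {M E E' ι : Type*} [TopologicalSpace M] [T2Space M]
    [NormedAddCommGroup E] [NormedSpace ℝ E] [ProperSpace E] [NormedAddCommGroup E']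
    (Z Y : Set M) (C : Set E') (hC : IsCompact C) (φ : ι → E × E' → M)
    (hcont : ∀ a, ContinuousOn (φ a) (closedBall 0 1 ×ˢ C))
    (hinj : ∀ a, Set.InjOn (φ a) (closedBall 0 1 ×ˢ C))
    (hdisj : ∀ a b, a ≠ b →
      Disjoint (φ a '' (closedBall 0 1 ×ˢ C)) (φ b '' (closedBall 0 1 ×ˢ C)))
    (hZ : IsClosed Z) (hZY : Z ⊆ Y) (hφY : ∀ a, φ a '' (closedBall 0 1 ×ˢ C) ⊆ Y)
    (hcover : Y ⊆ Z ∪ ⋃ a, φ a '' (closedBall 0 1 ×ˢ C))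
    (hmem : ∀ a, ∀ x ∈ closedBall (0 : E) 1, ∀ c ∈ C, φ a (x, c) ∈ Z ↔ ‖x‖ = 1) :
    HandleAttachment E C Z Y ι where
  i := ⟨Set.inclusion hZY, continuous_inclusion hZY⟩
  e a := ⟨fun p => ⟨φ a (p.1, p.2), hφY a ⟨_, ⟨p.1.2, p.2.2⟩, rfl⟩⟩, by
    refine Continuous.subtype_mk ((hcont a).comp_continuous
      (f := fun p : closedBall (0 : E) 1 × C => ((p.1 : E), (p.2 : E'))) (by fun_prop)
      fun p => ⟨p.1.2, p.2.2⟩) _⟩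
  isClosedEmbedding_i := by
    refine ⟨IsEmbedding.inclusion hZY, ?_⟩
    rw [ContinuousMap.coe_mk, Set.range_inclusion]
    exact hZ.preimage continuous_subtype_val
  isClosedEmbedding_e a := by
    have : CompactSpace C := isCompact_iff_compactSpace.1 hC
    have : CompactSpace (closedBall (0 : E) 1) :=
      isCompact_iff_compactSpace.1 (isCompact_closedBall 0 1)
    refine Continuous.isClosedEmbedding (ContinuousMap.continuous _) ?_
    rintro ⟨x, c⟩ ⟨x', c'⟩ h
    have := hinj a ⟨x.2, c.2⟩ ⟨x'.2, c'.2⟩ (congr_arg Subtype.val h)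
    obtain ⟨h1, h2⟩ := Prod.mk.inj this
    exact Prod.ext (Subtype.ext h1) (Subtype.ext h2)
  disjoint a b hab := by
    rw [Set.disjoint_left]
    rintro _ ⟨p, rfl⟩ ⟨p', h⟩
    exact Set.disjoint_left.1 (hdisj a b hab) ⟨_, ⟨p.1.2, p.2.2⟩, rfl⟩
      ⟨_, ⟨p'.1.2, p'.2.2⟩, congr_arg Subtype.val h⟩
  cover y := by
    rcases hcover y.2 with h | h
    · exact .inl ⟨⟨y, h⟩, rfl⟩
    · obtain ⟨a, ⟨x, c⟩, ⟨hx, hc⟩, h⟩ := Set.mem_iUnion.1 h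
      exact .inr ⟨a, (⟨x, hx⟩, ⟨c, hc⟩), Subtype.ext h⟩
  mem_range_iff a x c := by
    rw [← hmem a x x.2 c c.2]
    constructor
    · rintro ⟨z, h⟩
      have h' : (z : M) = φ a (x, c) := congr_arg Subtype.val h
      rw [← h']
      exact z.2
    · exact fun h => ⟨⟨_, h⟩, rfl⟩

end HandleAttachment

/-! ### Point-set topology of the level sets and the two descriptions of `Q`. -/

namespace HandleSystem

variable {M : Type*} (H : HandleSystem M)

/-- The union of the handles of index `k`. -/
def handles (k : ℕ) : Set M := ⋃ i, H.h k i '' stdHandle k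

theorem sub_mono {j k : ℕ} (h : j ≤ k) : H.sub j ⊆ H.sub k := by
  intro x hx
  simp only [sub, Set.mem_iUnion] at hx ⊢
  obtain ⟨l, hl, hx⟩ := hx
  exact ⟨l, hl.trans_le h, hx⟩

theorem handles_subset_sub {j k : ℕ} (h : j < k) : H.handles j ⊆ H.sub k := by
  intro x hx
  simp only [sub, handles, Set.mem_iUnion] at hx ⊢
  exact ⟨j, h, hx⟩

theorem mem_handles {k : ℕ} (i : Fin (H.num k)) {p : Euc k × Euc (4 - k)} (hp : p ∈ stdHandle k) :
    H.h k i p ∈ H.handles k :=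
  Set.mem_iUnion.2 ⟨i, p, hp, rfl⟩

theorem beltRegion_subset (k : ℕ) : beltRegion k ⊆ stdHandle k :=
  Set.prod_mono subset_rfl sphere_subset_closedBall

theorem attachingRegion_subset (k : ℕ) : attachingRegion k ⊆ stdHandle k :=
  Set.prod_mono sphere_subset_closedBall subset_rfl

theorem openAttachingRegion_subset (k : ℕ) : openAttachingRegion k ⊆ attachingRegion k :=
  Set.prod_mono subset_rfl ball_subset_closedBall

theorem belt_subset_handles (k : ℕ) : ⋃ i, H.h k i '' beltRegion k ⊆ H.handles k :=
  Set.iUnion_mono fun _ => Set.image_mono (beltRegion_subset k)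

theorem bd_succ_subset (k : ℕ) : H.bd (k + 1) ⊆ H.bd k ∪ H.handles k :=
  Set.union_subset_union Set.sdiff_subset (H.belt_subset_handles k)

theorem bd_subset_sub (k : ℕ) : H.bd k ⊆ H.sub k := by
  induction k with
  | zero => exact Set.empty_subset _
  | succ k ih =>
    exact (H.bd_succ_subset k).trans (Set.union_subset (ih.trans (H.sub_mono k.le_succ))
      (H.handles_subset_sub k.lt_succ_self))

theorem belt_subset_bd (k : ℕ) : ⋃ i, H.h k i '' beltRegion k ⊆ H.bd (k + 1) :=
  Set.subset_union_right

theorem isCompact_stdHandle (k : ℕ) : IsCompact (stdHandle k) :=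
  (isCompact_closedBall _ _).prod (isCompact_closedBall _ _)

variable {H} [TopologicalSpace M]

namespace IsDecomposition

variable (hH : H.IsDecomposition)
include hH

theorem h_eq_iff {k : ℕ} {i j : Fin (H.num k)} {p p' : Euc k × Euc (4 - k)}
    (hp : p ∈ stdHandle k) (hp' : p' ∈ stdHandle k) :
    H.h k i p = H.h k j p' ↔ i = j ∧ p = p' := by
  constructor
  · intro h
    by_cases hij : i = j
    · subst hij
      exact ⟨rfl, hH.injOn k i hp hp' h⟩
    · exact (Set.disjoint_left.1 (hH.disjoint k i j hij) ⟨p, hp, rfl⟩ ⟨p', hp', h.symm⟩).elim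
  · rintro ⟨rfl, rfl⟩
    rfl

theorem mem_iUnion_image_iff {k : ℕ} {i : Fin (H.num k)} {p : Euc k × Euc (4 - k)}
    (hp : p ∈ stdHandle k) {S : Set (Euc k × Euc (4 - k))} (hS : S ⊆ stdHandle k) :
    H.h k i p ∈ ⋃ j, H.h k j '' S ↔ p ∈ S := by
  constructor
  · intro h
    obtain ⟨j, p', hp', h⟩ := Set.mem_iUnion.1 h
    rw [((hH.h_eq_iff (hS hp') hp).1 h).2] at hp'
    exact hp'
  · exact fun h => Set.mem_iUnion.2 ⟨i, p, h, rfl⟩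

theorem attaching_subset_bd (k : ℕ) (i : Fin (H.num k)) :
    H.h k i '' attachingRegion k ⊆ H.bd k := by
  obtain ⟨ψ, -, -, heq, hsub, -⟩ := hH.tube k i
  rw [← heq.image_eq]
  exact (Set.image_mono (Set.prod_mono subset_rfl (closedBall_subset_closedBall one_le_two))).trans
    hsub

/-- A point of a `k`-handle lies in a set between the boundary and the union of the lower handles
if and only if it lies in the attaching region. -/
theorem mem_iff_norm_fst {k : ℕ} {Z : Set M} (h1 : H.bd k ⊆ Z) (h2 : Z ⊆ H.sub k)
    (i : Fin (H.num k)) {p : Euc k × Euc (4 - k)} (hp : p ∈ stdHandle k) :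
    H.h k i p ∈ Z ↔ ‖p.1‖ = 1 := by
  constructor
  · intro h
    have : H.h k i p ∈ H.h k i '' attachingRegion k := by
      rw [← hH.inter_sub]
      exact ⟨⟨p, hp, rfl⟩, h2 h⟩
    obtain ⟨p', hp', h⟩ := this
    rw [hH.injOn k i (attachingRegion_subset k hp') hp h] at hp'
    simpa using hp'.1
  · intro h
    exact h1 (hH.attaching_subset_bd k i ⟨p, ⟨by simpa using h, hp.2⟩, rfl⟩)

/-- Attaching the `k`-handle removes such points from the boundary. They never return: a later belt
point lying in a lower handle is an attaching point, hence was already in the preceding boundary. -/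
theorem notMem_bd {k j : ℕ} (hkj : k < j) (i : Fin (H.num k)) {p : Euc k × Euc (4 - k)}
    (hp : p ∈ stdHandle k) (hp2 : ‖p.2‖ < 1) : H.h k i p ∉ H.bd j := by
  induction j, hkj using Nat.le_induction with
  | base =>
    rintro (⟨h, h'⟩ | h)
    · rw [hH.mem_iff_norm_fst subset_rfl (H.bd_subset_sub k) i hp] at h
      rw [hH.mem_iUnion_image_iff hp
        ((openAttachingRegion_subset k).trans (attachingRegion_subset k))] at h'
      exact h' ⟨by simpa using h, by simpa using hp2⟩
    · rw [hH.mem_iUnion_image_iff hp (beltRegion_subset k)] at h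
      have : ‖p.2‖ = 1 := by simpa using h.2
      exact hp2.ne this
  | succ j hkj ih =>
    rintro (⟨h, -⟩ | h)
    · exact ih h
    · obtain ⟨l, hl⟩ := Set.mem_iUnion.1 h
      refine ih (hH.attaching_subset_bd j l ?_)
      rw [← hH.inter_sub]
      exact ⟨Set.image_mono (beltRegion_subset j) hl, H.handles_subset_sub hkj (H.mem_handles i hp)⟩

theorem notMem_handles {k j : ℕ} (hkj : k < j) (i : Fin (H.num k)) {p : Euc k × Euc (4 - k)}
    (hp : p ∈ stdHandle k) (hp2 : ‖p.2‖ < 1) : H.h k i p ∉ H.handles j := by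
  intro h
  obtain ⟨l, hl⟩ := Set.mem_iUnion.1 h
  refine hH.notMem_bd hkj i hp hp2 (hH.attaching_subset_bd j l ?_)
  rw [← hH.inter_sub]
  exact ⟨hl, H.handles_subset_sub hkj (H.mem_handles i hp)⟩

theorem isCompact_image [T2Space M] (k : ℕ) (i : Fin (H.num k)) {S : Set (Euc k × Euc (4 - k))}
    (hS : S ⊆ stdHandle k) (hSc : IsClosed S) : IsCompact (H.h k i '' S) :=
  ((isCompact_stdHandle k).of_isClosed_subset hSc hS).image_of_continuousOn
    ((hH.continuousOn k i).mono hS)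

theorem isClosed_handles [T2Space M] (k : ℕ) : IsClosed (H.handles k) :=
  isClosed_iUnion_of_finite fun i => (hH.isCompact_image k i subset_rfl
    (isCompact_stdHandle k).isClosed).isClosed

/-- The larger tube replaces invariance of domain: its interior is open in the boundary, so what
remains is a closed set together with the compact image of the shell between radii 1 and 2. -/
theorem isClosed_bd_sdiff [T2Space M] {k : ℕ} (hk : IsClosed (H.bd k)) (i : Fin (H.num k)) :
    IsClosed (H.bd k \ H.h k i '' openAttachingRegion k) := by
  obtain ⟨ψ, hψc, hψi, heq, hsub, U, hU, hUeq⟩ := hH.tube k i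
  have hcl : IsClosed (ψ '' (sphere 0 1 ×ˢ (closedBall 0 2 \ ball 0 1))) := by
    refine (IsCompact.image_of_continuousOn ?_ (hψc.mono (Set.prod_mono subset_rfl
      Set.sdiff_subset))).isClosed
    exact (isCompact_sphere _ _).prod ((isCompact_closedBall _ _).diff isOpen_ball)
  have : H.bd k \ H.h k i '' openAttachingRegion k =
      (H.bd k \ U) ∪ ψ '' (sphere 0 1 ×ˢ (closedBall 0 2 \ ball 0 1)) := by
    rw [← (heq.mono (openAttachingRegion_subset k)).image_eq]
    ext x
    constructor
    · rintro ⟨hx, hx'⟩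
      by_cases hxU : x ∈ U
      · right
        obtain ⟨p, hp, rfl⟩ : x ∈ ψ '' (sphere 0 1 ×ˢ ball 0 2) := by
          rw [hUeq]
          exact ⟨hxU, hx⟩
        exact ⟨p, ⟨hp.1, ball_subset_closedBall hp.2, fun h => hx' ⟨p, ⟨hp.1, h⟩, rfl⟩⟩, rfl⟩
      · exact .inl ⟨hx, hxU⟩
    · have hb2 : ∀ {p : Euc k × Euc (4 - k)}, p ∈ openAttachingRegion k →
          p ∈ sphere (0 : Euc k) 1 ×ˢ ball (0 : Euc (4 - k)) 2 := fun hp =>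
        ⟨hp.1, ball_subset_ball one_le_two hp.2⟩
      rintro (⟨hx, hx'⟩ | ⟨p, ⟨hp1, hp2, hp3⟩, rfl⟩)
      · refine ⟨hx, ?_⟩
        rintro ⟨p, hp, rfl⟩
        have : ψ p ∈ U ∩ H.bd k := by
          rw [← hUeq]
          exact ⟨p, hb2 hp, rfl⟩
        exact hx' this.1
      · refine ⟨hsub ⟨p, ⟨hp1, hp2⟩, rfl⟩, ?_⟩
        rintro ⟨p', hp', h⟩
        have := hψi ⟨(hb2 hp').1, ball_subset_closedBall (hb2 hp').2⟩ ⟨hp1, hp2⟩ h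
        rw [this] at hp'
        exact hp3 hp'.2
  rw [this]
  exact (hk.sdiff hU).union hcl

theorem isClosed_bd [T2Space M] (k : ℕ) : IsClosed (H.bd k) := by
  induction k with
  | zero => exact isClosed_empty
  | succ k ih =>
    refine IsClosed.union ?_ (isClosed_iUnion_of_finite fun i =>
      (hH.isCompact_image k i (beltRegion_subset k)
        (isClosed_closedBall.prod isClosed_sphere)).isClosed)
    -- The extra factor `H.bd k` covers the case of no `k`-handles, where the intersection is the
    -- whole space.
    have : H.bd k \ ⋃ i, H.h k i '' openAttachingRegion k =
        H.bd k ∩ ⋂ i, (H.bd k \ H.h k i '' openAttachingRegion k) := by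
      ext x
      simp only [Set.mem_sdiff, Set.mem_iUnion, not_exists, Set.mem_inter_iff, Set.mem_iInter]
      exact ⟨fun h => ⟨h.1, fun i => ⟨h.1, h.2 i⟩⟩, fun h => ⟨h.1, fun i => (h.2 i).2⟩⟩
    rw [this]
    exact ih.inter (isClosed_iInter fun i => hH.isClosed_bd_sdiff ih i)

theorem Q_eq_L1_sdiff : H.Q = H.L1 \ ⋃ i, H.h 2 i '' openAttachingRegion 2 := by
  ext x
  constructor
  · rintro ⟨h1, h3⟩
    refine ⟨h1, fun h => ?_⟩
    rcases h3 with h3 | h3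
    · exact h3.2 h
    · obtain ⟨i, p, hp, rfl⟩ := Set.mem_iUnion.1 h3
      rw [hH.mem_iUnion_image_iff (beltRegion_subset 2 hp)
        ((openAttachingRegion_subset 2).trans (attachingRegion_subset 2))] at h
      exact sphere_disjoint_ball.notMem_of_mem_left hp.2 h.2
  · exact fun h => ⟨h.1, .inl h⟩

/-- By `mem_iff_norm_fst`, a belt point lies in `L₁` exactly when its first coordinate is on the
unit circle. -/
theorem Q_eq_L3_sdiff : H.Q = H.L3 \ ⋃ i, H.h 2 i '' openBeltRegion 2 := by
  have hsub : openBeltRegion 2 ⊆ beltRegion 2 := Set.prod_mono ball_subset_closedBall subset_rfl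
  ext x
  constructor
  · rintro ⟨h1, h3⟩
    refine ⟨h3, fun h => ?_⟩
    obtain ⟨i, p, hp, rfl⟩ := Set.mem_iUnion.1 h
    have := (hH.mem_iff_norm_fst subset_rfl (H.bd_subset_sub 2) i
      (beltRegion_subset 2 (hsub hp))).1 h1
    exact (mem_ball_zero_iff.1 hp.1).ne this
  · rintro ⟨h3, h⟩
    refine ⟨?_, h3⟩
    rcases h3 with h3 | h3
    · exact h3.1
    · obtain ⟨i, p, hp, rfl⟩ := Set.mem_iUnion.1 h3
      refine (hH.mem_iff_norm_fst subset_rfl (H.bd_subset_sub 2) i (beltRegion_subset 2 hp)).2 ?_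
      rw [hH.mem_iUnion_image_iff (beltRegion_subset 2 hp) (hsub.trans (beltRegion_subset 2))] at h
      by_contra hne
      exact h ⟨mem_ball_zero_iff.2 (lt_of_le_of_ne (mem_closedBall_zero_iff.1 hp.1) hne), hp.2⟩

end IsDecomposition

end HandleSystem

/-! ### The handle attachments occurring in `M`. -/

theorem simplyConnectedSpace_closedBall (n : ℕ) :
    SimplyConnectedSpace (closedBall (0 : Euc n) 1) :=
  have : ContractibleSpace (closedBall (0 : Euc n) 1) :=
    (convex_closedBall _ _).contractibleSpace ⟨0, by simp⟩
  .ofContractible _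

theorem one_lt_rank_euc {n : ℕ} (hn : 1 < n) : 1 < Module.rank ℝ (Euc n) := by
  rw [← Module.finrank_eq_rank, finrank_euclideanSpace_fin]
  exact_mod_cast hn

namespace HandleSystem

theorem swap_image {M : Type*} {H : HandleSystem M} {k : ℕ} (i : Fin (H.num k))
    (S : Set (Euc (4 - k))) (T : Set (Euc k)) :
    (H.h k i ∘ Prod.swap) '' (S ×ˢ T) = H.h k i '' (T ×ˢ S) := by
  rw [Set.image_comp, Set.image_swap_prod]

variable {M : Type*} {H : HandleSystem M} [TopologicalSpace M] [T2Space M]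

namespace IsDecomposition

variable (hH : H.IsDecomposition)

/-- Attaching the `k`-handles to a closed set between the boundary and the union of the
lower handles. -/
noncomputable def attach {k : ℕ} {Z : Set M} (hZ : IsClosed Z) (h1 : H.bd k ⊆ Z)
    (h2 : Z ⊆ H.sub k) :
    HandleAttachment (Euc k) (closedBall (0 : Euc (4 - k)) 1) Z ↥(Z ∪ H.handles k)
      (Fin (H.num k)) :=
  .ofSubsets Z (Z ∪ H.handles k) (closedBall 0 1) (isCompact_closedBall _ _) (H.h k)
    (hH.continuousOn k) (hH.injOn k) (hH.disjoint k) hZ Set.subset_union_left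
    (fun a => Set.subset_union_of_subset_right (Set.subset_iUnion (fun i => H.h k i '' _) a) _)
    subset_rfl (fun a _ hx _ hc => hH.mem_iff_norm_fst h1 h2 a ⟨hx, hc⟩)

/-- Attaching the `k`-handles upside down. -/
noncomputable def attachDual {k : ℕ} {Z : Set M} (hZ : IsClosed Z)
    (hmem : ∀ i, ∀ p ∈ stdHandle k, H.h k i p ∈ Z ↔ ‖p.2‖ = 1) :
    HandleAttachment (Euc (4 - k)) (closedBall (0 : Euc k) 1) Z ↥(Z ∪ H.handles k)
      (Fin (H.num k)) :=
  .ofSubsets Z (Z ∪ H.handles k) (closedBall 0 1) (isCompact_closedBall _ _)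
    (fun i => H.h k i ∘ Prod.swap)
    (fun i => (hH.continuousOn k i).comp continuous_swap.continuousOn fun _ hp => ⟨hp.2, hp.1⟩)
    (fun i => (hH.injOn k i).comp Prod.swap_injective.injOn fun _ hp => ⟨hp.2, hp.1⟩)
    (fun i j hij => by
      rw [swap_image, swap_image]
      exact hH.disjoint k i j hij) hZ Set.subset_union_left
    (fun i => by
      rw [swap_image]
      exact Set.subset_union_of_subset_right (Set.subset_iUnion (fun i => H.h k i '' _) i) _)
    (by
      simp only [swap_image]
      exact subset_rfl)
    (fun i x hx c hc => hmem i (c, x) ⟨hc, hx⟩)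

/-- `L₁` is obtained from `Q` by attaching the tubes around the attaching circles. -/
noncomputable def attachL1 :
    HandleAttachment (Euc (4 - 2)) (sphere (0 : Euc 2) 1) H.Q H.L1 (Fin (H.num 2)) :=
  .ofSubsets H.Q H.L1 (sphere 0 1) (isCompact_sphere _ _)
    (fun i => H.h 2 i ∘ Prod.swap)
    (fun i => (hH.continuousOn 2 i).comp continuous_swap.continuousOn fun _ hp =>
      ⟨sphere_subset_closedBall hp.2, hp.1⟩)
    (fun i => (hH.injOn 2 i).comp Prod.swap_injective.injOn fun _ hp =>
      ⟨sphere_subset_closedBall hp.2, hp.1⟩)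
    (fun i j hij => by
      rw [swap_image, swap_image]
      exact (hH.disjoint 2 i j hij).mono (Set.image_mono (attachingRegion_subset 2))
        (Set.image_mono (attachingRegion_subset 2)))
    ((hH.isClosed_bd 2).inter (hH.isClosed_bd 3)) Set.inter_subset_left
    (fun i => by
      rw [swap_image]
      exact hH.attaching_subset_bd 2 i)
    (by
      simp only [swap_image]
      intro x hx
      by_cases h : x ∈ ⋃ i, H.h 2 i '' openAttachingRegion 2
      · exact .inr (Set.iUnion_mono (fun i => Set.image_mono (openAttachingRegion_subset 2)) h)
      · left
        rw [hH.Q_eq_L1_sdiff]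
        exact ⟨hx, h⟩)
    (fun i x hx c hc => by
      have hp : (c, x) ∈ attachingRegion 2 := ⟨hc, hx⟩
      rw [hH.Q_eq_L1_sdiff, Set.mem_sdiff, Function.comp_apply, Prod.swap_prod_mk,
        hH.mem_iUnion_image_iff (attachingRegion_subset 2 hp)
          ((openAttachingRegion_subset 2).trans (attachingRegion_subset 2))]
      have hx' : ‖x‖ ≤ 1 := mem_closedBall_zero_iff.1 hx
      constructor
      · rintro ⟨-, h⟩
        by_contra hne
        exact h ⟨hc, mem_ball_zero_iff.2 (lt_of_le_of_ne hx' hne)⟩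
      · intro h
        exact ⟨hH.attaching_subset_bd 2 i ⟨_, hp, rfl⟩, fun h' =>
          (mem_ball_zero_iff.1 h'.2).ne h⟩)

/-- `L₃` is obtained from `Q` by attaching the tubes around the co-circles. -/
noncomputable def attachL3 :
    HandleAttachment (Euc 2) (sphere (0 : Euc (4 - 2)) 1) H.Q H.L3 (Fin (H.num 2)) :=
  .ofSubsets H.Q H.L3 (sphere 0 1) (isCompact_sphere _ _) (H.h 2)
    (fun i => (hH.continuousOn 2 i).mono (beltRegion_subset 2))
    (fun i => (hH.injOn 2 i).mono (beltRegion_subset 2))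
    (fun i j hij => (hH.disjoint 2 i j hij).mono (Set.image_mono (beltRegion_subset 2))
        (Set.image_mono (beltRegion_subset 2)))
    ((hH.isClosed_bd 2).inter (hH.isClosed_bd 3)) Set.inter_subset_right
    (fun i => (Set.subset_iUnion (fun i => H.h 2 i '' beltRegion 2) i).trans (H.belt_subset_bd 2))
    (by
      rintro x (hx | hx)
      · left
        rw [hH.Q_eq_L1_sdiff]
        exact hx
      · exact .inr hx)
    (fun i x hx c hc => by
      have hp : (x, c) ∈ beltRegion 2 := ⟨hx, hc⟩
      rw [← hH.mem_iff_norm_fst subset_rfl (H.bd_subset_sub 2) i (beltRegion_subset 2 hp)]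
      exact ⟨fun h => h.1, fun h => ⟨h, H.belt_subset_bd 2
        (Set.mem_iUnion.2 ⟨i, _, hp, rfl⟩)⟩⟩)

include hH in
/-- In the union of `L₁` and the 2-handles, paths with the same ends are homotopic. -/
theorem homotopic_L1_union_handles [SimplyConnectedSpace M] {y y' : ↥(H.L1 ∪ H.handles 2)}
    (p q : Path y y') : p.Homotopic q := by
  have hcB := simplyConnectedSpace_closedBall
  have hL1 : IsClosed H.L1 := hH.isClosed_bd 2
  have hN := hL1.union (hH.isClosed_handles 2)
  have hN3 := hN.union (hH.isClosed_handles 3)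
  have hN4 := hN3.union (hH.isClosed_handles 4)
  have hN1 := hN4.union (hH.isClosed_handles 1)
  have hs2 : H.L1 ∪ H.handles 2 ⊆ H.sub 3 :=
    Set.union_subset ((H.bd_subset_sub 2).trans (H.sub_mono (by norm_num)))
      (H.handles_subset_sub (by norm_num))
  have hb3 : H.bd 3 ⊆ H.L1 ∪ H.handles 2 := H.bd_succ_subset 2
  have hs3 : H.L1 ∪ H.handles 2 ∪ H.handles 3 ⊆ H.sub 4 :=
    Set.union_subset (hs2.trans (H.sub_mono (by norm_num))) (H.handles_subset_sub (by norm_num))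
  have hb4 : H.bd 4 ⊆ H.L1 ∪ H.handles 2 ∪ H.handles 3 :=
    (H.bd_succ_subset 3).trans (Set.union_subset_union hb3 subset_rfl)
  have hdual : ∀ {k : ℕ}, k < 2 → ∀ i, ∀ p ∈ stdHandle k, ‖p.2‖ < 1 →
      H.h k i p ∉ H.L1 ∪ H.handles 2 ∪ H.handles 3 ∪ H.handles 4 := by
    rintro k hk i p hp hp2 (((h | h) | h) | h)
    · exact hH.notMem_bd hk i hp hp2 h
    all_goals exact hH.notMem_handles (by omega) i hp hp2 h
  have hle : ∀ {k : ℕ} {p : Euc k × Euc (4 - k)}, p ∈ stdHandle k → ¬ ‖p.2‖ < 1 → ‖p.2‖ = 1 :=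
    fun hp h => le_antisymm (mem_closedBall_zero_iff.1 hp.2) (not_lt.1 h)
  have hmem1 : ∀ i, ∀ p ∈ stdHandle 1,
      H.h 1 i p ∈ H.L1 ∪ H.handles 2 ∪ H.handles 3 ∪ H.handles 4 ↔ ‖p.2‖ = 1 := by
    intro i p hp
    refine ⟨fun h => hle hp fun h' => hdual (by norm_num) i p hp h' h, fun h => ?_⟩
    exact .inl (.inl (.inl (H.belt_subset_bd 1 (Set.mem_iUnion.2
      ⟨i, p, ⟨hp.1, by simpa using h⟩, rfl⟩))))
  have hmem0 : ∀ i, ∀ p ∈ stdHandle 0,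
      H.h 0 i p ∈ H.L1 ∪ H.handles 2 ∪ H.handles 3 ∪ H.handles 4 ∪ H.handles 1 ↔ ‖p.2‖ = 1 := by
    intro i p hp
    refine ⟨?_, fun h => ?_⟩
    · refine fun h => hle hp fun h' => ?_
      rcases h with h | h
      · exact hdual (by norm_num) i p hp h' h
      · exact hH.notMem_handles (by norm_num) i hp h' h
    · have h1 : H.h 0 i p ∈ H.bd 1 := H.belt_subset_bd 0 (Set.mem_iUnion.2
        ⟨i, p, ⟨hp.1, by simpa using h⟩, rfl⟩)
      -- A boundary point of the 0-handle is either covered by a 1-handle or survives in `L₁`.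
      by_cases h2 : H.h 0 i p ∈ ⋃ i, H.h 1 i '' openAttachingRegion 1
      · exact .inr (Set.iUnion_mono (fun i => Set.image_mono ((openAttachingRegion_subset 1).trans
          (attachingRegion_subset 1))) h2)
      · exact .inl (.inl (.inl (.inl (.inl ⟨h1, h2⟩))))
  have huniv : H.L1 ∪ H.handles 2 ∪ H.handles 3 ∪ H.handles 4 ∪ H.handles 1 ∪ H.handles 0 =
      Set.univ := by
    rw [Set.eq_univ_iff_forall]
    intro x
    have hx : x ∈ H.sub 5 := by rw [hH.sub_five]; trivial
    simp only [sub, Set.mem_iUnion] at hx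
    obtain ⟨j, hj, hx⟩ := hx
    have hx : x ∈ H.handles j := Set.mem_iUnion.2 hx
    interval_cases j <;> simp [hx]
  have h0 : ∀ {y y' : ↥(H.L1 ∪ H.handles 2 ∪ H.handles 3 ∪ H.handles 4 ∪ H.handles 1 ∪
      H.handles 0)} (p q : Path y y'), p.Homotopic q := by
    rw [huniv]
    have : SimplyConnectedSpace (Set.univ : Set M) :=
      (Homeomorph.Set.univ M).toHomotopyEquiv.simplyConnectedSpace
    exact fun {_ _} p q => SimplyConnectedSpace.paths_homotopic p q
  -- The handles of index 0, 1, 4, 3 are removed in this order; their cores, dual ones for index 0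
  -- and 1, have dimensions 4, 3, 4, 3.
  have h1 := fun {y y'} => (hH.attachDual hN1 hmem0).homotopic_of_forall_homotopic
    (by norm_num) h0 (z := y) (z' := y')
  have h2 := fun {y y'} => (hH.attachDual hN4 hmem1).homotopic_of_forall_homotopic
    (by norm_num) h1 (z := y) (z' := y')
  have h3 := fun {y y'} => (hH.attach hN3 hb4 hs3).homotopic_of_forall_homotopic
    (by norm_num) h2 (z := y) (z' := y')
  exact (hH.attach hN hb3 hs2).homotopic_of_forall_homotopic (by norm_num) h3 p q

end IsDecomposition

end HandleSystem

/-! ### The Goursat argument and surjectivity onto the product. -/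

/-- A homomorphism to a product is onto if its components are onto and its range contains the
first factor. -/
theorem surjective_of_comap_inl_eq_top {Γ G₁ G₃ : Type*} [Group Γ] [Group G₁] [Group G₃]
    (f : Γ →* G₁ × G₃) (h3 : ∀ g, ∃ γ, (f γ).2 = g)
    (h : f.range.comap (MonoidHom.inl G₁ G₃) = ⊤) : Function.Surjective f := by
  rintro ⟨g₁, g₃⟩
  obtain ⟨γ, hγ⟩ := h3 g₃
  have : g₁ * (f γ).1⁻¹ ∈ f.range.comap (MonoidHom.inl G₁ G₃) := by rw [h]; trivial
  obtain ⟨δ, hδ⟩ := this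
  refine ⟨δ * γ, ?_⟩
  rw [map_mul, hδ]
  ext <;> simp [hγ]

/-- A conjugating element lifts to `Γ`, and conjugation by its image keeps the second coordinate
equal to 1. -/
theorem comap_inl_range_normal {Γ G₁ G₃ : Type*} [Group Γ] [Group G₁] [Group G₃]
    (f : Γ →* G₁ × G₃) (h1 : ∀ g, ∃ γ, (f γ).1 = g) :
    (f.range.comap (MonoidHom.inl G₁ G₃)).Normal := by
  refine ⟨fun n hn g => ?_⟩
  obtain ⟨δ, hδ⟩ := hn
  obtain ⟨γ, rfl⟩ := h1 g
  refine ⟨γ * δ * γ⁻¹, ?_⟩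
  rw [map_mul, map_mul, map_inv, hδ]
  ext <;> simp

/-- The value of a path functor on a loop in `X × B`, `B` simply connected, is conjugate to the
value on its projection to any slice `X × {y}`. -/
theorem PathHom.val_eq_one_of_slice {X B G : Type*} [TopologicalSpace X] [TopologicalSpace B]
    [Group G] [SimplyConnectedSpace B] (Ψ : PathHom (X × B) G) (y : B)
    (h : ∀ {x : X} (p : Path x x), Ψ.val (p.prod (Path.refl y)) = 1)
    {w : X × B} (p : Path w w) : Ψ.val p = 1 := by
  obtain ⟨x, v⟩ := w
  let s : Path v y := PathConnectedSpace.somePath v y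
  let p₁ : Path x x := p.map continuous_fst
  let p₂ : Path v v := p.map continuous_snd
  let m : Path (x, v) (x, y) := (Path.refl x).prod s
  have hm : (p.trans m).Homotopic (m.trans (p₁.prod (Path.refl y))) := by
    have hp : p = p₁.prod p₂ := rfl
    rw [hp, Path.trans_prod_eq_prod_trans, Path.trans_prod_eq_prod_trans]
    exact ⟨Path.Homotopic.prodHomotopy
      ((Path.Homotopic.trans_refl p₁).trans (Path.Homotopic.refl_trans p₁).symm).some
      (SimplyConnectedSpace.paths_homotopic _ _).some⟩
  have := Ψ.homotopic hm
  rw [Ψ.trans, Ψ.trans, h p₁, mul_one] at this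
  simpa using this

/-- If the loop `m` realizes the pair, then `ca⁻¹ m cb` is the required path. -/
theorem HandleSystem.exists_path_of_piOneMap_surjective {M : Type*} [TopologicalSpace M]
    {H : HandleSystem M} {q a b : H.Q} (hs : Function.Surjective (H.piOneMap q))
    (ca : Path q a) (cb : Path q b) (g₁ : FundamentalGroup H.L1 (H.inclL1 q))
    (g₃ : FundamentalGroup H.L3 (H.inclL3 q)) :
    ∃ l : Path a b,
      FundamentalGroup.fromPath (Path.Homotopic.Quotient.mk
        (((ca.trans l).trans cb.symm).map H.inclL1.continuous)) = g₁ ∧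
      FundamentalGroup.fromPath (Path.Homotopic.Quotient.mk
        (((ca.trans l).trans cb.symm).map H.inclL3.continuous)) = g₃ := by
  obtain ⟨γ, hγ⟩ := hs (g₁, g₃)
  obtain ⟨m, rfl⟩ := Path.Homotopic.Quotient.mk_surjective γ
  have hm : ((ca.trans ((ca.symm.trans m).trans cb)).trans cb.symm).Homotopic m := by
    rw [← Path.Homotopic.Quotient.eq]
    simp only [Path.Homotopic.Quotient.mk_trans, Path.Homotopic.Quotient.mk_symm]
    grind
  exact ⟨(ca.symm.trans m).trans cb,
    (Path.Homotopic.Quotient.eq.2 (hm.map H.inclL1)).trans (congr_arg Prod.fst hγ),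
    (Path.Homotopic.Quotient.eq.2 (hm.map H.inclL3)).trans (congr_arg Prod.snd hγ)⟩

theorem HandleSystem.mem_L3 {M : Type*} {H : HandleSystem M} (i : Fin (H.num 2))
    (x : closedBall (0 : Euc 2) 1) (y : sphere (0 : Euc (4 - 2)) 1) : H.h 2 i (x, y) ∈ H.L3 :=
  H.belt_subset_bd 2 (Set.mem_iUnion.2 ⟨i, ((x : Euc 2), (y : Euc (4 - 2))), ⟨x.2, y.2⟩, rfl⟩)

namespace HandleSystem.IsDecomposition

variable {M : Type*} {H : HandleSystem M} [TopologicalSpace M] [T2Space M]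
  (hH : H.IsDecomposition)
include hH

theorem exists_piOneMap_fst (q : H.Q) (g : FundamentalGroup H.L1 (H.inclL1 q)) :
    ∃ γ, (H.piOneMap q γ).1 = g := by
  obtain ⟨γ, rfl⟩ := Path.Homotopic.Quotient.mk_surjective g
  obtain ⟨r, hr⟩ := hH.attachL1.exists_path_homotopic_map
    (one_lt_rank_euc (by norm_num)) (z := q) (z' := q) γ
  exact ⟨FundamentalGroup.fromPath (Path.Homotopic.Quotient.mk r),
    (Path.Homotopic.Quotient.eq.2 hr).symm⟩

theorem exists_piOneMap_snd (q : H.Q) (g : FundamentalGroup H.L3 (H.inclL3 q)) :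
    ∃ γ, (H.piOneMap q γ).2 = g := by
  obtain ⟨γ, rfl⟩ := Path.Homotopic.Quotient.mk_surjective g
  obtain ⟨r, hr⟩ := hH.attachL3.exists_path_homotopic_map
    (one_lt_rank_euc (by norm_num)) (z := q) (z' := q) γ
  exact ⟨FundamentalGroup.fromPath (Path.Homotopic.Quotient.mk r),
    (Path.Homotopic.Quotient.eq.2 hr).symm⟩

omit [T2Space M] in
/-- Loops parallel to the attaching circles are trivial in `L₃`. -/
theorem homotopic_refl_of_parallel (i : Fin (H.num 2)) (y : sphere (0 : Euc (4 - 2)) 1)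
    {x : sphere (0 : Euc 2) 1} (p : Path x x) {z : H.L3} (p' : Path z z)
    (hp' : ∀ t, (p' t : M) = H.h 2 i (p t, y)) : p'.Homotopic (Path.refl z) := by
  have := simplyConnectedSpace_closedBall 2
  have hcont : Continuous fun x : closedBall (0 : Euc 2) 1 => H.h 2 i (x, y) :=
    (hH.continuousOn 2 i).comp_continuous
      (f := fun x : closedBall (0 : Euc 2) 1 => ((x : Euc 2), (y : Euc (4 - 2))))
      (by fun_prop) fun x => ⟨x.2, sphere_subset_closedBall y.2⟩
  -- The disc `D² × y` lies in the belt region because `‖y‖ = 1`.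
  let κ : C(closedBall (0 : Euc 2) 1, H.L3) :=
    ⟨fun x => ⟨H.h 2 i (x, y), mem_L3 i x y⟩, hcont.subtype_mk _⟩
  let b : closedBall (0 : Euc 2) 1 := ⟨x, sphere_subset_closedBall x.2⟩
  let c : Path b b := (p.map continuous_subtype_val).codRestrict fun t =>
    sphere_subset_closedBall (p t).2
  have hκ : ∀ t, κ (c t) = p' t := fun t => Subtype.ext (hp' t).symm
  obtain rfl : κ b = z := by simpa using hκ 0
  have h := (SimplyConnectedSpace.paths_homotopic c (Path.refl b)).map κ
  have hc : c.map κ.continuous = p' := Path.ext (funext hκ)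
  rwa [hc] at h

/-- The attaching circles are trivial modulo the classes in the range that vanish in `L₃`. -/
theorem val_attaching_eq_one {G : Type*} [Group G] (q : H.Q)
    (φ : FundamentalGroup H.L1 (H.inclL1 q) →* G)
    (hφ : ∀ γ, (H.piOneMap q γ).2 = 1 → φ (H.piOneMap q γ).1 = 1) (i : Fin (H.num 2))
    (y : sphere (0 : Euc (4 - 2)) 1) {x : sphere (0 : Euc 2) 1} (p : Path x x)
    {z : H.L1} (p' : Path z z) (hp' : ∀ t, (p' t : M) = H.h 2 i (p t, y)) :
    (PathHom.ofFundamentalGroup φ).val p' = 1 := by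
  by_cases hz : Joined (H.inclL1 q) z
  swap
  · exact PathHom.ofFundamentalGroup_val_of_not_joined φ p' hz
  have hQ : ∀ t, (p' t : M) ∈ H.Q := fun t =>
    ⟨(p' t).2, by rw [hp']; exact mem_L3 i ⟨p t, sphere_subset_closedBall (p t).2⟩ y⟩
  have hzQ : (z : M) ∈ H.Q := by simpa using hQ 0
  let p'' : Path (⟨z, hzQ⟩ : H.Q) ⟨z, hzQ⟩ := (p'.map continuous_subtype_val).codRestrict hQ
  obtain ⟨δ⟩ := hz
  -- The connecting path is pushed into `Q`, so that the conjugated circle `L` is a loop in `Q`, to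
  -- which `hφ` applies.
  obtain ⟨r, hr⟩ := hH.attachL1.exists_path_homotopic_map
    (one_lt_rank_euc (by norm_num)) (z := q) (z' := ⟨z, hzQ⟩) δ
  let L : Path q q := (r.trans p'').trans r.symm
  have hdisc : (p''.map H.inclL3.continuous).Homotopic (Path.refl _) :=
    hH.homotopic_refl_of_parallel i y p _ hp'
  have h3 : (H.piOneMap q (FundamentalGroup.fromPath (Path.Homotopic.Quotient.mk L))).2 = 1 := by
    change Path.Homotopic.Quotient.mk (L.map H.inclL3.continuous) =
      Path.Homotopic.Quotient.refl _
    rw [← Path.Homotopic.Quotient.mk_refl, Path.Homotopic.Quotient.eq, Path.map_trans,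
      Path.map_trans]
    refine ((((Path.Homotopic.refl _).hcomp hdisc).trans (Path.Homotopic.trans_refl _)).hcomp
      (.refl _)).trans ?_
    rw [← Path.map_symm]
    exact Path.Homotopic.trans_symm _
  have h1 : (PathHom.ofFundamentalGroup φ).val (L.map H.inclL1.continuous) = 1 :=
    (PathHom.ofFundamentalGroup_val_eq_one_iff φ _).2 (hφ _ h3)
  rw [Path.map_trans, Path.map_trans, PathHom.trans, PathHom.trans, ← Path.map_symm,
    PathHom.val_symm, mul_inv_eq_one, mul_eq_left] at h1
  exact h1

theorem surjective_piOneMap [SimplyConnectedSpace M] (q : H.Q) :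
    Function.Surjective (H.piOneMap q) := by
  refine surjective_of_comap_inl_eq_top _ (hH.exists_piOneMap_snd q) ?_
  have hN := comap_inl_range_normal (H.piOneMap q) (hH.exists_piOneMap_fst q)
  let φ := QuotientGroup.mk' ((H.piOneMap q).range.comap (MonoidHom.inl _ _))
  have hφ : ∀ γ, (H.piOneMap q γ).2 = 1 → φ (H.piOneMap q γ).1 = 1 := by
    intro γ hγ
    exact (QuotientGroup.eq_one_iff _).2 ⟨γ, Prod.ext rfl hγ⟩
  rw [Subgroup.eq_top_iff']
  intro g
  obtain ⟨(γ : Path (H.inclL1 q) (H.inclL1 q)), rfl⟩ :=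
    Path.Homotopic.Quotient.mk_surjective g
  let A := hH.attach (hH.isClosed_bd 2) subset_rfl (H.bd_subset_sub 2)
  have hcB := simplyConnectedSpace_closedBall
  have hS : PathConnectedSpace (sphere (0 : Euc 2) 1) :=
    isPathConnected_iff_pathConnectedSpace.1
      (isPathConnected_sphere (one_lt_rank_euc (by norm_num)) 0 zero_le_one)
  have hv := A.val_eq_of_homotopic_map (PathHom.ofFundamentalGroup φ) ?_ γ (Path.refl _)
    (hH.homotopic_L1_union_handles _ _)
  · exact (QuotientGroup.eq_one_iff _).1 ((PathHom.ofFundamentalGroup_val_eq_one_iff φ γ).1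
      (hv.trans (PathHom.val_refl _ _)))
  · intro i w p
    -- Loops in `S¹ × D²` are slid to the slice over a boundary point `y`, where they lie in `Q`.
    obtain ⟨y, hy⟩ := (isPathConnected_sphere (E := Euc (4 - 2)) (one_lt_rank_euc (by norm_num)) 0
      zero_le_one).nonempty
    refine ((PathHom.ofFundamentalGroup φ).comp (A.att i)).val_eq_one_of_slice
      ⟨y, sphere_subset_closedBall hy⟩ (fun {x} p => ?_) p
    refine hH.val_attaching_eq_one q φ hφ i ⟨y, hy⟩ p _ fun t => ?_
    exact congr_arg Subtype.val (A.i_att i (p t, ⟨y, sphere_subset_closedBall hy⟩))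

end HandleSystem.IsDecomposition

end

theorem mainTheorem4 {M : Type*} [TopologicalSpace M] [T2Space M] [CompactSpace M]
    [ChartedSpace (EuclideanSpace ℝ (Fin 4)) M] [SimplyConnectedSpace M]
    (H : HandleSystem M) (hH : H.IsDecomposition) :
    -- `Q` is `L₁` minus (open tubes around) the attaching circles of the 2-handles,
    -- and it is also `L₃` minus (open tubes around) their co-circles
    H.Q = H.L1 \ ⋃ α, H.h 2 α '' openAttachingRegion 2 ∧
    H.Q = H.L3 \ ⋃ α, H.h 2 α '' openBeltRegion 2 ∧
    -- the map of fundamental groups is onto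
    (∀ q : H.Q, Function.Surjective (H.piOneMap q)) ∧
    -- an arc in `Q` from `a` to `b`, where `a` and `b` are joined to the base point `q` by given
    -- arcs `ca` and `cb`, can be chosen to represent any given pair of elements
    (∀ (q a b : H.Q) (ca : Path q a) (cb : Path q b)
      (g₁ : FundamentalGroup H.L1 (H.inclL1 q)) (g₃ : FundamentalGroup H.L3 (H.inclL3 q)),
      ∃ l : Path a b,
        FundamentalGroup.fromPath
            (Path.Homotopic.Quotient.mk
              (((ca.trans l).trans cb.symm).map H.inclL1.continuous)) = g₁ ∧
        FundamentalGroup.fromPath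
            (Path.Homotopic.Quotient.mk
              (((ca.trans l).trans cb.symm).map H.inclL3.continuous)) = g₃) := by
  exact ⟨hH.Q_eq_L1_sdiff, hH.Q_eq_L3_sdiff, hH.surjective_piOneMap, fun q _ _ ca cb g₁ g₃ =>
    HandleSystem.exists_path_of_piOneMap_surjective (hH.surjective_piOneMap q) ca cb g₁ g₃⟩
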